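/- Let $n\ge 0$, $N=2^n$ and $1\le K\le N$. Let $\mathbf G=\mathbf F^{\otimes n}$ over the binary field with $\mathbf F=\left[\begin{smallmatrix}1&0\\1&1\end{smallmatrix}\right]$, rows and columns numbered $0,\dots,N-1$, and for $\mathcal A\subseteq\{0,\dots,N-1\}$ let $\mathcal C(\mathcal A)=\{\mathbf u\mathbf G : u_i=0 \text{ for } i\notin\mathcal A\}$. For nonempty $\mathcal A$ let $d_{\min}(\mathcal A)$ be the minimum Hamming weight of the nonzero codewords of $\mathcal C(\mathcal A)$ and $A_{d_{\min}}(\mathcal A)$ the number of codewords of that weight. To $0\le i<N$ with binary digits $b_0^i,\dots,b_{n-1}^i$ ($b^i_0$ least significant) assign the monomial $f_i=\prod_{l:\,b_l^i=0}x_l=x_{i_1}\cdots x_{i_D}$, $i_1<\dots<i_D$, $D=\deg f_i$. For monomials of the same degree $D$, $f_i\preceq f_j$ means $i_m\le j_m$ for $m=1,\dots,D$; for different degrees, $f_i\preceq f_j$ means $f_i\preceq f^*$ for some divisor $f^*$ of $f_j$ with $\deg f^*=\deg f_i$. An $(N,K)$ polar (decreasing monomial) code is a code $\mathcal C(\mathcal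 A)$ with $|\mathcal A|=K$ such that $f_i\preceq f_j$ and $j\in\mathcal A$ imply $i\in\mathcal A$. Put $A_i=2^{D+|\lambda_{f_i}|}$ with $D=\deg f_i$ and $|\lambda_{f_i}|=\frac{D(1-D)}2+\sum_{m=1}^{D}i_m$. The MWD sequence $\mathbf q=[q_0,\dots,q_{N-1}]$ lists $0,\dots,N-1$ by increasing $\deg f_i$, indices with equal degree by increasing $A_i$, and indices with equal degree and equal $A_i$ by decreasing $i$. Let $\mathcal A=\{q_0,\dots,q_{K-1}\}$. Then $\mathcal C(\mathcal A)$ is an $(N,K)$ polar code, and for every $(N,K)$ polar code $\mathcal C(\mathcal A')$: 1. $d_{\min}(\mathcal A')\le d_{\min}(\mathcal A)$; 2. if $d_{\min}(\mathcal A')=d_{\min}(\mathcal A)$, then $A_{d_{\min}}(\mathcal A)\le A_{d_{\min}}(\mathcal A')$. Moreover $\mathcal C(\mathcal A)$ is optimal for the approximate union bound at high SNR: with $R=K/N$ and $Q(x)=\frac1{\sqrt{2\pi}}\int_x^\infty e^{-t^2/2}\,dt$, there is $\gamma_0$ such that for all $E_b,N_0>0$ with $E_b/N_0\ge\gamma_0$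 and all $(N,K)$ polar codes $\mathcal C(\mathcal A')$, $$A_{d_{\min}}(\mathcal A)\,Q\!\left(\sqrt{\frac{2d_{\min}(\mathcal A)RE_b}{N_0}}\right)\le A_{d_{\min}}(\mathcal A')\,Q\!\left(\sqrt{\frac{2d_{\min}(\mathcal A')RE_b}{N_0}}\right).$$ -/

import Mathlib

open scoped Matrix Kronecker

/-! ## Polar codes -/

/-- The kernel `F = [1 0; 1 1]` over the binary field. -/
def polarKernel : Matrix (Fin 2) (Fin 2) (ZMod 2) := !![1, 0; 1, 1]

/-- The Kronecker power `F^{⊗n}`, with rows and columns numbered `0, …, 2^n - 1` in the usual way: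
the pair `(i, b)` of an index `i` of `F^{⊗n}` and an index `b` of `F` has number `2 * i + b`. -/
def polarMatrix : (n : ℕ) → Matrix (Fin (2 ^ n)) (Fin (2 ^ n)) (ZMod 2)
  | 0 => 1
  | n + 1 => Matrix.reindex finProdFinEquiv finProdFinEquiv (polarMatrix n ⊗ₖ polarKernel)

/-- The binary linear code `{u G : u_i = 0 for i ∉ A}`, `G = F^{⊗n}`, of the information set `A`. -/
def polarCode {n : ℕ} (A : Finset (Fin (2 ^ n))) : Set (Fin (2 ^ n) → ZMod 2) :=
  {c | ∃ u : Fin (2 ^ n) → ZMod 2, (∀ i, i ∉ A → u i = 0) ∧ c = u ᵥ* polarMatrix n}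

/-- The minimum Hamming weight `d_min` of the nonzero codewords. -/
noncomputable def minWeight {N : ℕ} (C : Set (Fin N → ZMod 2)) : ℕ :=
  sInf {w | ∃ c ∈ C, c ≠ 0 ∧ hammingNorm c = w}

/-- The distance spectrum: the number `A_d` of codewords of Hamming weight `d`. -/
noncomputable def weightCount {N : ℕ} (C : Set (Fin N → ZMod 2)) (d : ℕ) : ℕ :=
  {c | c ∈ C ∧ hammingNorm c = d}.ncard

/-- The number `A_{d_min}` of codewords of minimum weight. -/
noncomputable def minWeightCount {N : ℕ} (C : Set (Fin N → ZMod 2)) : ℕ :=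
  weightCount C (minWeight C)

/-! ## Monomials and the partial order -/

/-- The monomial `f_i`, given by the set of the indices `l` of its variables `x_l`: these are the
positions of the zeros in the binary representation of `i` (position `0` is least significant). -/
def polarMonomial {n : ℕ} (i : Fin (2 ^ n)) : Finset (Fin n) :=
  Finset.univ.filter fun l => (i : ℕ).testBit l = false

/-- The order between monomials of the same degree: if `s = {s_1 < … < s_D}` and
`t = {t_1 < … < t_D}`, then `s_m ≤ t_m` for all `m`. -/
def MonomialLESame {n : ℕ} (s t : Finset (Fin n)) : Prop :=
  ∃ h : s.card = t.card,
    ∀ m : Fin t.card, s.orderEmbOfFin h m ≤ t.orderEmbOfFin rfl m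

/-- The partial order `⪯` on monomials; for different degrees `s ⪯ t` means that `s ⪯ t'` for
some divisor `t'` of `t` (which has the degree of `s`). -/
def MonomialLE {n : ℕ} (s t : Finset (Fin n)) : Prop :=
  MonomialLESame s t ∨ (s.card ≠ t.card ∧ ∃ t', t' ⊆ t ∧ MonomialLESame s t')

/-- `A` is the information set of an `(N, K)` polar code, `N = 2^n`, that is, of a decreasing
monomial code of dimension `K`. -/
def IsPolarInfoSet (n K : ℕ) (A : Finset (Fin (2 ^ n))) : Prop :=
  A.card = K ∧ ∀ i j, MonomialLE (polarMonomial i) (polarMonomial j) → j ∈ A → i ∈ A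

/-! ## The MWD sequence -/

/-- `|λ_{f_i}| = D (1 - D) / 2 + ∑_m i_m` for `f_i = x_{i_1} ⋯ x_{i_D}`. The subtraction in `ℕ` is
exact, as the `i_m` are `D` distinct natural numbers. -/
def lambdaCard {n : ℕ} (i : Fin (2 ^ n)) : ℕ :=
  (∑ l ∈ polarMonomial i, (l : ℕ))
    - (polarMonomial i).card * ((polarMonomial i).card - 1) / 2

/-- The second entry `A_i = 2^{deg f_i + |λ_{f_i}|}` of the partial minimum weight distribution
of the `i`-th synthetic channel; the first one is `d_i = 2^{n - deg f_i}`. -/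
def partialCount {n : ℕ} (i : Fin (2 ^ n)) : ℕ :=
  2 ^ ((polarMonomial i).card + lambdaCard i)

/-- `B_r`: the indices of the monomials of degree `r`, that is, those with `d_i = 2^{n - r}`. -/
def degreeBlock (n r : ℕ) : Finset (Fin (2 ^ n)) :=
  Finset.univ.filter fun i => (polarMonomial i).card = r

/-- The elements of `T` with the least `A_i`. -/
def argminCount {n : ℕ} (T : Finset (Fin (2 ^ n))) : Finset (Fin (2 ^ n)) :=
  T.filter fun i => ∀ j ∈ T, partialCount i ≤ partialCount j

theorem argminCount_nonempty {n : ℕ} {T : Finset (Fin (2 ^ n))} (hT : T.Nonempty) :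
    (argminCount T).Nonempty := by
  obtain ⟨a, ha, h⟩ := T.exists_min_image partialCount hT
  exact ⟨a, Finset.mem_filter.2 ⟨ha, h⟩⟩

/-- The most reliable index in `T`: the largest of those with the least `A_i`. -/
def mwdPick {n : ℕ} (T : Finset (Fin (2 ^ n))) (hT : T.Nonempty) : Fin (2 ^ n) :=
  (argminCount T).max' (argminCount_nonempty hT)

theorem mwdPick_mem {n : ℕ} (T : Finset (Fin (2 ^ n))) (hT : T.Nonempty) : mwdPick T hT ∈ T :=
  (Finset.mem_filter.1 (Finset.max'_mem _ (argminCount_nonempty hT))).1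

/-- The ordering of a block: repeatedly remove the most reliable index. -/
def mwdBlock {n : ℕ} (T : Finset (Fin (2 ^ n))) : List (Fin (2 ^ n)) :=
  if hT : T.Nonempty then mwdPick T hT :: mwdBlock (T.erase (mwdPick T hT)) else []
termination_by T.card
decreasing_by exact Finset.card_erase_lt_of_mem (mwdPick_mem T hT)

/-- The MWD sequence `q` of length `N = 2^n`: the ordered blocks `B_0, B_1, …, B_n` in turn. -/
def mwdSeq (n : ℕ) : List (Fin (2 ^ n)) :=
  (List.range (n + 1)).flatMap fun r => mwdBlock (degreeBlock n r)

/-- The information set `{q_0, …, q_{K-1}}`. -/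
def mwdInfoSet (n K : ℕ) : Finset (Fin (2 ^ n)) :=
  ((mwdSeq n).take K).toFinset

/-! ## The approximate union bound -/

/-- The Gaussian tail `Q(x) = (2π)^{-1/2} ∫_x^∞ exp(-t²/2) dt`. -/
noncomputable def gaussianQ (x : ℝ) : ℝ :=
  1 / Real.sqrt (2 * Real.pi) * ∫ t in Set.Ioi x, Real.exp (-t ^ 2 / 2)

/-- The approximate union bound `A_{d_min} Q(√(2 d_min R E_b / N_0))` of the polar code with
information set `A`, whose rate is `R = |A| / 2^n`. -/
noncomputable def approxUnionBound {n : ℕ} (A : Finset (Fin (2 ^ n))) (Eb N0 : ℝ) : ℝ :=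
  (minWeightCount (polarCode A) : ℝ) *
    gaussianQ (Real.sqrt
      (2 * (minWeight (polarCode A) : ℝ) * ((A.card : ℝ) / (2 : ℝ) ^ n) * Eb / N0))

/-! The words of `polarCode A` are the evaluations on 𝔽₂ⁿ of the polynomials whose monomials are the
`f_i` with `i ∈ A`. If `r` is the largest degree that occurs, a decreasing code has the Reed-Muller
distance `2^(n-r)`, and its number of minimum weight words is the sum of the `A_i` over the `i ∈ A`
of degree `r` (`card_minWeight_evalCode`). Optimality is then a greedy argument
(`mwdInfoSet_optimal`): the MWD set uses degree `r` only after exhausting all smaller degrees, so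
its `r` is least possible; within degree `r` it takes as few indices as possible, and those with the
least `A_i`. It is a polar code because passing to a strictly smaller monomial lowers the degree, or
keeps it and lowers `A_i`.

The count is by induction on the number of variables, writing `f = g + x_n h`, which is the Plotkin
(u | u+v) construction. If `h ≠ 0`, then `f` has minimum weight exactly when `h` is a minimum weight
word of degree one less and `g` is an affine function on its support, which is a flat, extended by
zero. There are `2 * hammingNorm h` such `g`, and decreasingness puts all of them in the code.

At high SNR a larger distance beats any multiplicity, because the Gaussian tail decays exponentially
(`gaussianQ_add_le`); only finitely many codes have to be compared. -/

/-! ## Evaluation codes of monomials -/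

/-- The evaluation function of the monomial `∏ l ∈ s, x_l`. -/
def monomialEval {n : ℕ} (s : Finset (Fin n)) (x : Fin n → ZMod 2) : ZMod 2 :=
  ∏ l ∈ s, x l

/-- The space of evaluations of the polynomials all of whose monomials lie in `M`. -/
def evalCode {n : ℕ} (M : Finset (Finset (Fin n))) :
    Submodule (ZMod 2) ((Fin n → ZMod 2) → ZMod 2) :=
  Submodule.span (ZMod 2) (monomialEval '' (M : Set (Finset (Fin n))))

/-- The function `g + x_n h` in `n + 1` variables. -/
def joinLast {n : ℕ} (g h : (Fin n → ZMod 2) → ZMod 2) (x : Fin (n + 1) → ZMod 2) : ZMod 2 :=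
  g (Fin.init x) + x (Fin.last n) * h (Fin.init x)

/-- The monomials of `M` without the last variable. -/
def lowerPart {n : ℕ} (M : Finset (Finset (Fin (n + 1)))) : Finset (Finset (Fin n)) :=
  Finset.univ.filter fun s => s.map Fin.castSuccEmb ∈ M

/-- The cofactors of the last variable in the monomials of `M`. -/
def upperPart {n : ℕ} (M : Finset (Finset (Fin (n + 1)))) : Finset (Finset (Fin n)) :=
  Finset.univ.filter fun s => insert (Fin.last n) (s.map Fin.castSuccEmb) ∈ M

theorem mem_lowerPart {n : ℕ} {M : Finset (Finset (Fin (n + 1)))} {s : Finset (Fin n)} :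
    s ∈ lowerPart M ↔ s.map Fin.castSuccEmb ∈ M := by simp [lowerPart]

theorem mem_upperPart {n : ℕ} {M : Finset (Finset (Fin (n + 1)))} {s : Finset (Fin n)} :
    s ∈ upperPart M ↔ insert (Fin.last n) (s.map Fin.castSuccEmb) ∈ M := by simp [upperPart]

theorem last_notMem_map {n : ℕ} (s : Finset (Fin n)) :
    Fin.last n ∉ s.map Fin.castSuccEmb := by
  simp [Fin.castSucc_ne_last]

theorem card_insert_last {n : ℕ} (s : Finset (Fin n)) :
    (insert (Fin.last n) (s.map Fin.castSuccEmb)).card = s.card + 1 := by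
  rw [Finset.card_insert_of_notMem (last_notMem_map s), Finset.card_map]

theorem eq_map_or_eq_insert {n : ℕ} (s : Finset (Fin (n + 1))) :
    ∃ t : Finset (Fin n), s = t.map Fin.castSuccEmb ∨
      s = insert (Fin.last n) (t.map Fin.castSuccEmb) := by
  refine ⟨Finset.univ.filter fun i => i.castSucc ∈ s, ?_⟩
  by_cases h : Fin.last n ∈ s
  · right
    ext i
    induction i using Fin.lastCases with
    | last => simp [h]
    | cast i => simp [Fin.castSucc_ne_last]
  · left
    ext i
    induction i using Fin.lastCases with
    | last => simp [h, Fin.castSucc_ne_last]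
    | cast i => simp

theorem monomialEval_map {n : ℕ} (s : Finset (Fin n)) :
    monomialEval (s.map Fin.castSuccEmb) = joinLast (monomialEval s) 0 := by
  ext x
  simp [monomialEval, joinLast, Fin.init]

theorem monomialEval_insert {n : ℕ} (s : Finset (Fin n)) :
    monomialEval (insert (Fin.last n) (s.map Fin.castSuccEmb)) =
      joinLast 0 (monomialEval s) := by
  ext x
  simp [monomialEval, joinLast, Fin.init, Finset.prod_insert (last_notMem_map s)]

/-- `joinLast` as a linear equivalence. -/
def joinEquiv (n : ℕ) :
    (((Fin n → ZMod 2) → ZMod 2) × ((Fin n → ZMod 2) → ZMod 2)) ≃ₗ[ZMod 2]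
      ((Fin (n + 1) → ZMod 2) → ZMod 2) where
  toFun p := joinLast p.1 p.2
  map_add' p q := by
    ext x
    simp only [joinLast, Prod.fst_add, Prod.snd_add, Pi.add_apply]
    ring
  map_smul' c p := by
    ext x
    simp only [joinLast, Prod.smul_fst, Prod.smul_snd, Pi.smul_apply, smul_eq_mul,
      RingHom.id_apply]
    ring
  invFun f := (fun x => f (Fin.snoc x 0), fun x => f (Fin.snoc x 1) - f (Fin.snoc x 0))
  left_inv p := by
    refine Prod.ext ?_ ?_ <;> ext x <;> simp [joinLast]
  right_inv f := by
    ext x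
    have hx : ∀ c, x (Fin.last n) = c → Fin.snoc (Fin.init x) c = x := by
      rintro _ rfl
      exact Fin.snoc_init_self x
    have h01 : ∀ c : ZMod 2, c = 0 ∨ c = 1 := by decide
    rcases h01 (x (Fin.last n)) with h | h
    · simp [joinLast, h, hx 0 h]
    · simp [joinLast, h, hx 1 h]

theorem joinEquiv_apply {n : ℕ} (g h : (Fin n → ZMod 2) → ZMod 2) :
    joinEquiv n (g, h) = joinLast g h := rfl

/-- Every monomial either avoids the last variable or is that variable times its cofactor, so the
code is the direct sum of the two pieces. This drives every induction on the number of variables. -/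
theorem joinLast_mem {n : ℕ} {M : Finset (Finset (Fin (n + 1)))}
    {g h : (Fin n → ZMod 2) → ZMod 2} :
    joinLast g h ∈ evalCode M ↔ g ∈ evalCode (lowerPart M) ∧ h ∈ evalCode (upperPart M) := by
  have key : evalCode M = ((evalCode (lowerPart M)).prod (evalCode (upperPart M))).map
      (joinEquiv n).toLinearMap := by
    apply le_antisymm
    · refine Submodule.span_le.2 ?_
      rintro _ ⟨s, hs, rfl⟩
      obtain ⟨t, rfl | rfl⟩ := eq_map_or_eq_insert s
      · exact ⟨(monomialEval t, 0), ⟨Submodule.subset_span ⟨t, mem_lowerPart.2 hs, rfl⟩,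
          Submodule.zero_mem _⟩, (monomialEval_map t).symm⟩
      · exact ⟨(0, monomialEval t), ⟨Submodule.zero_mem _,
          Submodule.subset_span ⟨t, mem_upperPart.2 hs, rfl⟩⟩, (monomialEval_insert t).symm⟩
    · rintro _ ⟨⟨g, h⟩, ⟨hg, hh⟩, rfl⟩
      have h1 : evalCode (lowerPart M) ≤ (evalCode M).comap
          ((joinEquiv n).toLinearMap ∘ₗ LinearMap.inl _ _ _) := by
        refine Submodule.span_le.2 ?_
        rintro _ ⟨t, ht, rfl⟩
        refine Submodule.subset_span ⟨_, mem_lowerPart.1 ht, ?_⟩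
        exact monomialEval_map t
      have h2 : evalCode (upperPart M) ≤ (evalCode M).comap
          ((joinEquiv n).toLinearMap ∘ₗ LinearMap.inr _ _ _) := by
        refine Submodule.span_le.2 ?_
        rintro _ ⟨t, ht, rfl⟩
        refine Submodule.subset_span ⟨_, mem_upperPart.1 ht, ?_⟩
        exact monomialEval_insert t
      have h3 := (evalCode M).add_mem (h1 hg) (h2 hh)
      simpa [← map_add] using h3
  rw [key]
  constructor
  · rintro ⟨p, hp, he⟩
    have : p = (g, h) := (joinEquiv n).injective he
    subst this
    exact hp
  · exact fun hgh => ⟨(g, h), hgh, rfl⟩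

theorem exists_joinLast {n : ℕ} (f : (Fin (n + 1) → ZMod 2) → ZMod 2) :
    ∃ g h, f = joinLast g h :=
  ⟨_, _, ((joinEquiv n).right_inv f).symm⟩

theorem joinLast_eq_zero {n : ℕ} {g h : (Fin n → ZMod 2) → ZMod 2} :
    joinLast g h = 0 ↔ g = 0 ∧ h = 0 := by
  rw [← joinEquiv_apply, LinearEquiv.map_eq_zero_iff, Prod.mk_eq_zero]

theorem hammingNorm_eq_sum {ι : Type*} [Fintype ι] (f : ι → ZMod 2) :
    hammingNorm f = ∑ x, (f x).val := by
  rw [hammingNorm, Finset.card_filter]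
  refine Finset.sum_congr rfl fun x _ => ?_
  have : ∀ c : ZMod 2, (if c ≠ 0 then 1 else 0) = c.val := by decide
  exact this _

/-- On the hyperplane where the last variable is 0 the function is `g`, and where it is 1 it is `g +
h`. -/
theorem hammingNorm_joinLast {n : ℕ} (g h : (Fin n → ZMod 2) → ZMod 2) :
    hammingNorm (joinLast g h) = hammingNorm g + hammingNorm (g + h) := by
  simp only [hammingNorm_eq_sum]
  rw [← (Fin.snocEquiv fun _ => ZMod 2).sum_comp, Fintype.sum_prod_type]
  have : ∀ F : ZMod 2 → ℕ, ∑ c, F c = F 0 + F 1 := fun F => Fin.sum_univ_two F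
  rw [this]
  simp [joinLast, Fin.snocEquiv]

theorem hammingNorm_le_joinLast {n : ℕ} (g h : (Fin n → ZMod 2) → ZMod 2) :
    hammingNorm h ≤ hammingNorm (joinLast g h) := by
  rw [hammingNorm_joinLast]
  simp only [hammingNorm_eq_sum, ← Finset.sum_add_distrib]
  refine Finset.sum_le_sum fun x _ => ?_
  have : ∀ a b : ZMod 2, b.val ≤ a.val + (a + b).val := by decide
  exact this _ _

theorem hammingNorm_joinLast_eq_iff {n : ℕ} (g h : (Fin n → ZMod 2) → ZMod 2) :
    hammingNorm (joinLast g h) = hammingNorm h ↔ ∀ x, h x = 0 → g x = 0 := by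
  rw [hammingNorm_joinLast, eq_comm]
  simp only [hammingNorm_eq_sum, ← Finset.sum_add_distrib]
  rw [Finset.sum_eq_sum_iff_of_le]
  · refine ⟨fun H x => ?_, fun H x _ => ?_⟩
    · have : ∀ a b : ZMod 2, b.val = a.val + (a + b).val → b = 0 → a = 0 := by decide
      exact this _ _ (H x (Finset.mem_univ x))
    · have : ∀ a b : ZMod 2, (b = 0 → a = 0) → b.val = a.val + (a + b).val := by decide
      exact this _ _ (H x)
  · intro x _
    have : ∀ a b : ZMod 2, b.val ≤ a.val + (a + b).val := by decide
    exact this _ _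

theorem card_le_of_mem_lowerPart {n r : ℕ} {M : Finset (Finset (Fin (n + 1)))}
    (hM : ∀ s ∈ M, s.card ≤ r) : ∀ s ∈ lowerPart M, s.card ≤ r := by
  intro s hs
  simpa using hM _ (mem_lowerPart.1 hs)

theorem card_lt_of_mem_upperPart {n r : ℕ} {M : Finset (Finset (Fin (n + 1)))}
    (hM : ∀ s ∈ M, s.card ≤ r) : ∀ s ∈ upperPart M, s.card + 1 ≤ r := by
  intro s hs
  rw [← card_insert_last]
  exact hM _ (mem_upperPart.1 hs)

/-- If the cofactor of the last variable is nonzero, the degree bound is positive. -/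
theorem exists_eq_succ_of_mem_upperPart {n r : ℕ} {M : Finset (Finset (Fin (n + 1)))}
    (hM : ∀ s ∈ M, s.card ≤ r) {h : (Fin n → ZMod 2) → ZMod 2}
    (hh : h ∈ evalCode (upperPart M)) (h0 : h ≠ 0) :
    ∃ q, r = q + 1 ∧ ∀ s ∈ upperPart M, s.card ≤ q := by
  have hne : (upperPart M).Nonempty := by
    rw [Finset.nonempty_iff_ne_empty]
    intro he
    simp [he, evalCode] at hh
    exact h0 hh
  obtain ⟨s, hs⟩ := hne
  have := card_lt_of_mem_upperPart hM
  refine ⟨r - 1, ?_, fun t ht => ?_⟩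
  · have := this s hs
    omega
  · have := this t ht
    omega

/-! ## The minimum distance of the Reed-Muller codes -/

/-- If `h ≠ 0`, the weight is at least that of `h`, whose degree bound is one lower; if `h = 0`, the
weight of `g` doubles. The product form avoids the subtraction `n - r` and needs no bound `r ≤ n`.
-/
theorem two_pow_le_hammingNorm {n r : ℕ} {M : Finset (Finset (Fin n))}
    (hM : ∀ s ∈ M, s.card ≤ r) {f : (Fin n → ZMod 2) → ZMod 2} (hf : f ∈ evalCode M)
    (h0 : f ≠ 0) : 2 ^ n ≤ hammingNorm f * 2 ^ r := by
  induction n generalizing r with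
  | zero =>
    have := hammingNorm_pos_iff.2 h0
    exact Nat.mul_pos this (by positivity)
  | succ n ih =>
    obtain ⟨g, h, rfl⟩ := exists_joinLast f
    obtain ⟨hg, hh⟩ := joinLast_mem.1 hf
    by_cases hz : h = 0
    · subst hz
      have hg0 : g ≠ 0 := fun e => h0 (joinLast_eq_zero.2 ⟨e, rfl⟩)
      have := ih (card_le_of_mem_lowerPart hM) hg hg0
      rw [hammingNorm_joinLast, add_zero, pow_succ]
      linarith
    · obtain ⟨q, rfl, hq⟩ := exists_eq_succ_of_mem_upperPart hM hh hz
      have := ih hq hh hz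
      have h2 := Nat.mul_le_mul_right (2 ^ q) (hammingNorm_le_joinLast g h)
      rw [pow_succ, pow_succ]
      linarith

theorem evalCode_mono {n : ℕ} {M M' : Finset (Finset (Fin n))} (h : M ⊆ M') :
    evalCode M ≤ evalCode M' :=
  Submodule.span_mono (Set.image_mono (Finset.coe_subset.2 h))

theorem mem_evalCode_filter {n r : ℕ} {M : Finset (Finset (Fin n))}
    (hM : ∀ s ∈ M, s.card ≤ r) {f : (Fin n → ZMod 2) → ZMod 2} (hf : f ∈ evalCode M) :
    f ∈ evalCode (Finset.univ.filter fun s : Finset (Fin n) => s.card ≤ r) :=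
  evalCode_mono (fun s hs => Finset.mem_filter.2 ⟨Finset.mem_univ s, hM s hs⟩) hf

/-- A minimum weight word of degree `q + 1` with a nonzero cofactor `h` of the last variable:
`h` is a minimum weight word of degree `q`, and the word vanishes outside its support. -/
theorem hammingNorm_upper_of_joinLast {n q : ℕ} {M : Finset (Finset (Fin n))}
    (hM : ∀ s ∈ M, s.card ≤ q) {g h : (Fin n → ZMod 2) → ZMod 2} (hh : h ∈ evalCode M)
    (h0 : h ≠ 0) (hw : hammingNorm (joinLast g h) * 2 ^ (q + 1) = 2 ^ (n + 1)) :
    hammingNorm h * 2 ^ q = 2 ^ n ∧ hammingNorm (joinLast g h) = hammingNorm h := by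
  have h1 := two_pow_le_hammingNorm hM hh h0
  have h2 := hammingNorm_le_joinLast g h
  rw [pow_succ, pow_succ] at hw
  have hw' : hammingNorm (joinLast g h) * 2 ^ q = 2 ^ n := by linarith
  have h3 : hammingNorm h * 2 ^ q = 2 ^ n :=
    le_antisymm (hw' ▸ Nat.mul_le_mul_right _ h2) h1
  exact ⟨h3, Nat.eq_of_mul_eq_mul_right (by positivity) (hw'.trans h3.symm)⟩

/-- The support of `f` is an affine subspace of `𝔽₂ⁿ`, or empty. -/
def SupportFlat {n : ℕ} (f : (Fin n → ZMod 2) → ZMod 2) : Prop :=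
  ∀ a b c, f a = 1 → f b = 1 → f c = 1 → f (a + b + c) = 1

/-- `g` vanishes outside the support of `h` and is affine on it. -/
def AffineOn {n : ℕ} (h g : (Fin n → ZMod 2) → ZMod 2) : Prop :=
  (∀ x, h x = 0 → g x = 0) ∧
    ∀ a b c, h a = 1 → h b = 1 → h c = 1 → g (a + b + c) = g a + g b + g c

theorem zmod_two_cases (c : ZMod 2) : c = 0 ∨ c = 1 := by
  revert c; decide

theorem add_self_eq_zero_fun {n : ℕ} (a : Fin n → ZMod 2) : a + a = 0 :=
  funext fun x => CharTwo.add_self_eq_zero (a x)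

theorem add_add_cancel_char_two {n : ℕ} (a b c : Fin n → ZMod 2) :
    a + b + (a + b + c) = c := by
  rw [← add_assoc, add_self_eq_zero_fun, zero_add]

theorem SupportFlat.ne_of_two_one {n : ℕ} {g : (Fin n → ZMod 2) → ZMod 2} (hg : SupportFlat g)
    {a b c : Fin n → ZMod 2} (ha : g a = 1) (hb : g b = 1) (hc : g c = 0) :
    g (a + b + c) = 0 := by
  rcases zmod_two_cases (g (a + b + c)) with h | h
  · exact h
  · have := hg _ _ _ ha hb h
    rw [add_add_cancel_char_two, hc] at this
    exact absurd this (by decide)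

/-- The supports of `g` and `g + h` cut the flat `{h = 1}` into two flats. Among three points two
lie in the same piece, and then `a + b + c` lies in the piece of the third; this is affinity over
𝔽₂. -/
theorem affineOn_of_supportFlat {n : ℕ} {g h : (Fin n → ZMod 2) → ZMod 2} (hg : SupportFlat g)
    (hgh : SupportFlat (g + h)) (hh : SupportFlat h) (hle : ∀ x, h x = 0 → g x = 0) :
    AffineOn h g := by
  refine ⟨hle, ?_⟩
  have two_one : ∀ a b c, h a = 1 → h b = 1 → h c = 1 → g a = g b →
      g (a + b + c) = g c := by
    intro a b c ha hb hc hab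
    have hd := hh a b c ha hb hc
    have e : ∀ u v : ZMod 2, v = 1 → (u = 0 ↔ u + v = 1) ∧ (u = 1 ↔ u + v = 0) := by decide
    have ea := e (g a) (h a) ha
    have eb := e (g b) (h b) hb
    have ec := e (g c) (h c) hc
    have ed := e (g (a + b + c)) _ hd
    rcases zmod_two_cases (g a) with h1 | h1 <;> rcases zmod_two_cases (g c) with h3 | h3
    · rw [h3]
      exact ed.1.2 (hgh a b c (ea.1.1 h1) (eb.1.1 (hab ▸ h1)) (ec.1.1 h3))
    · rw [h3]
      exact ed.2.2 (hgh.ne_of_two_one (ea.1.1 h1) (eb.1.1 (hab ▸ h1)) (ec.2.1 h3))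
    · rw [h3]
      exact hg.ne_of_two_one h1 (hab ▸ h1) h3
    · rw [h3]
      exact hg a b c h1 (hab ▸ h1) h3
  intro a b c ha hb hc
  have pigeon : ∀ u v w : ZMod 2, u = v ∨ u = w ∨ v = w := by decide
  have arith : ∀ u v : ZMod 2, u + u + v = v := by decide
  rcases pigeon (g a) (g b) (g c) with h1 | h1 | h1
  · rw [two_one a b c ha hb hc h1, h1, arith]
  · rw [add_right_comm, two_one a c b ha hc hb h1, add_right_comm (g a), h1, arith]
  · rw [add_assoc, add_comm, two_one b c a hb hc ha h1, add_assoc (g a), add_comm (g a), h1,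
      arith]

theorem init_add {n : ℕ} (a b : Fin (n + 1) → ZMod 2) :
    (Fin.init (a + b) : Fin n → ZMod 2) = (Fin.init a : Fin n → ZMod 2) + Fin.init b := rfl

/-- The support of `g + x_n h` is the graph of `1 + g` over the support of `h`, and the graph of an
affine function on a flat is a flat. -/
theorem supportFlat_joinLast {n : ℕ} {g h : (Fin n → ZMod 2) → ZMod 2} (hh : SupportFlat h)
    (hg : AffineOn h g) : SupportFlat (joinLast g h) := by
  have key : ∀ a : Fin (n + 1) → ZMod 2, joinLast g h a = 1 ↔
      h (Fin.init a) = 1 ∧ a (Fin.last n) = 1 + g (Fin.init a) := by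
    intro a
    have : ∀ u v w : ZMod 2, (v = 0 → u = 0) → (u + w * v = 1 ↔ v = 1 ∧ w = 1 + u) := by decide
    exact this _ _ _ (hg.1 _)
  intro a b c ha hb hc
  rw [key] at ha hb hc ⊢
  rw [init_add, init_add]
  refine ⟨hh _ _ _ ha.1 hb.1 hc.1, ?_⟩
  rw [hg.2 _ _ _ ha.1 hb.1 hc.1, Pi.add_apply, Pi.add_apply, ha.2, hb.2, hc.2]
  have : ∀ u v w : ZMod 2, 1 + u + (1 + v) + (1 + w) = 1 + (u + v + w) := by decide
  exact this _ _ _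

theorem AffineOn.of_supportFlat_joinLast {n : ℕ} {g h : (Fin n → ZMod 2) → ZMod 2}
    (hh : SupportFlat h) (hle : ∀ x, h x = 0 → g x = 0) (hf : SupportFlat (joinLast g h)) :
    AffineOn h g := by
  refine ⟨hle, fun a b c ha hb hc => ?_⟩
  have key : ∀ a, h a = 1 → joinLast g h (Fin.snoc a (1 + g a)) = 1 := by
    intro a ha
    have : ∀ u : ZMod 2, u + (1 + u) = 1 := by decide
    simp [joinLast, ha, this]
  have := hf _ _ _ (key a ha) (key b hb) (key c hc)
  simp only [joinLast, init_add, Fin.init_snoc, Pi.add_apply, Fin.snoc_last,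
    hh a b c ha hb hc] at this
  have e : ∀ d u v w : ZMod 2, d + (1 + u + (1 + v) + (1 + w)) * 1 = 1 → d = u + v + w := by
    decide
  exact e _ _ _ _ this

/-- The supports of the minimum weight words of a Reed-Muller code are flats. -/
theorem supportFlat_of_hammingNorm {n r : ℕ} {M : Finset (Finset (Fin n))}
    (hM : ∀ s ∈ M, s.card ≤ r) {f : (Fin n → ZMod 2) → ZMod 2} (hf : f ∈ evalCode M)
    (hw : hammingNorm f * 2 ^ r = 2 ^ n) : SupportFlat f := by
  induction n generalizing r with
  | zero =>
    intro a b c ha _ _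
    rwa [Subsingleton.elim (a + b + c) a]
  | succ n ih =>
    obtain ⟨g, h, rfl⟩ := exists_joinLast f
    obtain ⟨hg, hh⟩ := joinLast_mem.1 hf
    by_cases hz : h = 0
    · subst hz
      rw [hammingNorm_joinLast, add_zero, pow_succ] at hw
      have := ih (card_le_of_mem_lowerPart hM) hg (by linarith)
      intro a b c ha hb hc
      simp only [joinLast, Pi.zero_apply, mul_zero, add_zero] at *
      exact this _ _ _ ha hb hc
    · obtain ⟨q, rfl, hq⟩ := exists_eq_succ_of_mem_upperPart hM hh hz
      obtain ⟨hhw, hgh⟩ := hammingNorm_upper_of_joinLast hq hh hz hw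
      have hhf := ih hq hh hhw
      have hle := (hammingNorm_joinLast_eq_iff g h).1 hgh
      -- `g` and `h` lie in different codes, so both are moved into the full Reed-Muller code of
      -- degree `q + 1`, which also contains `g + h`.
      have hR := fun s (hs : s ∈ Finset.univ.filter fun s : Finset (Fin n) => s.card ≤ q + 1) =>
        (Finset.mem_filter.1 hs).2
      have hg' := mem_evalCode_filter (card_le_of_mem_lowerPart hM) hg
      have hh' := mem_evalCode_filter (fun s hs => (hq s hs).trans q.le_succ) hh
      have hs' := Submodule.add_mem _ hg' hh'
      rw [hammingNorm_joinLast] at hw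
      have flat0 : SupportFlat (0 : (Fin n → ZMod 2) → ZMod 2) :=
        fun _ _ _ ha => absurd ha (by simp)
      -- When both are nonzero, each of `g` and `g + h` has weight at least half of the total, so
      -- both have minimum weight for degree `q + 1` and the induction hypothesis applies to both.
      have hflat : SupportFlat g ∧ SupportFlat (g + h) := by
        by_cases hg0 : g = 0
        · subst hg0
          exact ⟨flat0, by rwa [zero_add]⟩
        by_cases hs0 : g + h = 0
        · have : g = h := by
            ext x
            have e : ∀ u v : ZMod 2, u + v = 0 → u = v := by decide
            exact e _ _ (congrFun hs0 x)
          exact ⟨this ▸ hhf, hs0 ▸ flat0⟩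
        have h1 := two_pow_le_hammingNorm hR hg' hg0
        have h2 := two_pow_le_hammingNorm hR hs' hs0
        rw [add_mul, pow_succ 2 n] at hw
        exact ⟨ih hR hg' (by linarith), ih hR hs' (by linarith)⟩
      exact supportFlat_joinLast hhf (affineOn_of_supportFlat hflat.1 hflat.2 hhf hle)

/-! ## Affine functions on a flat -/

/-- The direction of the flat `{h = 1}` through the point `p`. -/
def flatDirection {n : ℕ} {h : (Fin n → ZMod 2) → ZMod 2} (hh : SupportFlat h)
    {p : Fin n → ZMod 2} (hp : h p = 1) : Submodule (ZMod 2) (Fin n → ZMod 2) where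
  carrier := {v | h (p + v) = 1}
  zero_mem' := by simpa using hp
  add_mem' {v w} hv hw := by
    have := hh _ _ _ hv hw hp
    have e : p + v + (p + w) + p = p + (v + w) := by
      rw [show p + v + (p + w) + p = p + p + (p + (v + w)) by abel, add_self_eq_zero_fun,
        zero_add]
    rwa [e] at this
  smul_mem' c v hv := by
    rcases zmod_two_cases c with rfl | rfl
    · simpa using hp
    · simpa using hv

theorem mem_flatDirection {n : ℕ} {h : (Fin n → ZMod 2) → ZMod 2} (hh : SupportFlat h)
    {p : Fin n → ZMod 2} (hp : h p = 1) {v : Fin n → ZMod 2} :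
    v ∈ flatDirection hh hp ↔ h (p + v) = 1 := Iff.rfl

theorem add_add_self_left {n : ℕ} (p x : Fin n → ZMod 2) : p + (p + x) = x := by
  rw [← add_assoc, add_self_eq_zero_fun, zero_add]

/-- The linear part of an affine function on a flat. -/
def linearPart {n : ℕ} {h g : (Fin n → ZMod 2) → ZMod 2} (hh : SupportFlat h)
    {p : Fin n → ZMod 2} (hp : h p = 1) (hg : AffineOn h g) :
    Module.Dual (ZMod 2) (flatDirection hh hp) :=
  AddMonoidHom.toZModLinearMap 2
    { toFun := fun v => g (p + v) + g p
      map_zero' := by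
        simp only [ZeroMemClass.coe_zero, add_zero]
        exact CharTwo.add_self_eq_zero _
      map_add' := fun v w => by
        have h1 := hg.2 _ _ _ v.2 w.2 hp
        have e : p + (v : Fin n → ZMod 2) + (p + w) + p = p + ((v + w : flatDirection hh hp) :
            Fin n → ZMod 2) := by
          rw [show p + (v : Fin n → ZMod 2) + (p + w) + p = p + p + (p + (v + w)) by abel,
            add_self_eq_zero_fun, zero_add, Submodule.coe_add]
        rw [e] at h1
        rw [h1]
        abel }

theorem linearPart_apply {n : ℕ} {h g : (Fin n → ZMod 2) → ZMod 2} (hh : SupportFlat h)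
    {p : Fin n → ZMod 2} (hp : h p = 1) (hg : AffineOn h g) (v : flatDirection hh hp) :
    linearPart hh hp hg v = g (p + v) + g p := rfl

/-- The linear part extends from the direction of the flat to the whole space, so `g` becomes `h`
times a polynomial of degree at most one. -/
theorem exists_affine_extension {n : ℕ} {h g : (Fin n → ZMod 2) → ZMod 2} (hh : SupportFlat h)
    (h0 : h ≠ 0) (hg : AffineOn h g) :
    ∃ (e : ZMod 2) (L : (Fin n → ZMod 2) →ₗ[ZMod 2] ZMod 2), ∀ x, g x = h x * (e + L x) := by
  obtain ⟨p, hp⟩ := Function.ne_iff.1 h0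
  replace hp : h p = 1 := (zmod_two_cases _).resolve_left hp
  obtain ⟨L, hL⟩ := (linearPart hh hp hg).exists_extend
  refine ⟨g p + L p, L, fun x => ?_⟩
  rcases zmod_two_cases (h x) with hx | hx
  · rw [hx, zero_mul, hg.1 x hx]
  · have hv : p + x ∈ flatDirection hh hp := by
      rwa [mem_flatDirection, add_add_self_left]
    have h1 : L (p + x) = linearPart hh hp hg ⟨p + x, hv⟩ := by
      rw [← hL]; rfl
    rw [linearPart_apply, add_add_self_left, map_add] at h1
    rw [hx, one_mul, add_assoc, h1]
    have : ∀ u v : ZMod 2, u = v + (u + v) := by decide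
    exact this _ _

/-- An affine function on a flat is given by a value and a linear functional on the direction. -/
noncomputable def affineOnEquiv {n : ℕ} {h : (Fin n → ZMod 2) → ZMod 2} (hh : SupportFlat h)
    {p : Fin n → ZMod 2} (hp : h p = 1) :
    {g // AffineOn h g} ≃ ZMod 2 × Module.Dual (ZMod 2) (flatDirection hh hp) :=
  Equiv.ofBijective (fun g => (g.1 p, linearPart hh hp g.2)) <| by
    constructor
    · rintro ⟨g, hg⟩ ⟨g', hg'⟩ he
      simp only [Prod.mk.injEq] at he
      refine Subtype.ext (funext fun x => ?_)
      rcases zmod_two_cases (h x) with hx | hx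
      · exact (hg.1 x hx).trans (hg'.1 x hx).symm
      · have hv : p + x ∈ flatDirection hh hp := by
          rwa [mem_flatDirection, add_add_self_left]
        have h1 := DFunLike.congr_fun he.2 ⟨p + x, hv⟩
        rw [linearPart_apply, linearPart_apply, add_add_self_left, he.1] at h1
        exact add_right_cancel h1
    · rintro ⟨e, φ⟩
      obtain ⟨L, hL⟩ := φ.exists_extend
      have hg : AffineOn h fun x => h x * (e + L p + L x) := by
        refine ⟨fun x hx => by simp [hx], fun a b c ha hb hc => ?_⟩
        simp only [hh a b c ha hb hc, ha, hb, hc, map_add]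
        have : ∀ e u v w : ZMod 2, 1 * (e + (u + v + w)) = 1 * (e + u) + 1 * (e + v) + 1 * (e + w)
          := by decide
        exact this _ _ _ _
      refine ⟨⟨_, hg⟩, Prod.ext ?_ (LinearMap.ext fun v => ?_)⟩
      · simp only [hp, one_mul]
        rw [add_assoc, CharTwo.add_self_eq_zero, add_zero]
      · rw [linearPart_apply, ← hL]
        simp only [(mem_flatDirection hh hp).1 v.2, hp, map_add, LinearMap.comp_apply,
          Submodule.subtype_apply]
        have : ∀ e u v : ZMod 2, 1 * (e + u + (u + v)) + 1 * (e + u + u) = v := by decide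
        exact this _ _ _

theorem card_flatDirection {n : ℕ} {h : (Fin n → ZMod 2) → ZMod 2} (hh : SupportFlat h)
    {p : Fin n → ZMod 2} (hp : h p = 1) :
    Nat.card (flatDirection hh hp) = hammingNorm h := by
  rw [hammingNorm, ← Nat.card_eq_finsetCard]
  have e : ∀ u : ZMod 2, u ≠ 0 ↔ u = 1 := by decide
  refine Nat.card_congr
    ⟨fun v => ⟨p + v, by simpa [e] using (mem_flatDirection hh hp).1 v.2⟩,
      fun x => ⟨p + x, ?_⟩, fun v => ?_, fun x => ?_⟩
  · rw [mem_flatDirection, add_add_self_left]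
    simpa [e] using x.2
  · exact Subtype.ext (add_add_self_left _ _)
  · exact Subtype.ext (add_add_self_left _ _)

/-- The direction of the flat has as many elements as its dual and as the support of `h`; the factor
2 is the value at the base point. -/
theorem card_affineOn {n : ℕ} {h : (Fin n → ZMod 2) → ZMod 2} (hh : SupportFlat h)
    (h0 : h ≠ 0) : Nat.card {g // AffineOn h g} = 2 * hammingNorm h := by
  obtain ⟨p, hp⟩ := Function.ne_iff.1 h0
  replace hp : h p = 1 := (zmod_two_cases _).resolve_left hp
  rw [Nat.card_congr (affineOnEquiv hh hp), Nat.card_prod, ← card_flatDirection hh hp,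
    Module.natCard_eq_pow_finrank (K := ZMod 2) (V := Module.Dual (ZMod 2) _),
    Module.natCard_eq_pow_finrank (K := ZMod 2) (V := flatDirection hh hp),
    Subspace.dual_finrank_eq, Nat.card_zmod]

/-! ## Decreasing sets of monomials -/

/-- `M` is closed under divisors and under replacing a variable by a smaller one. -/
def IsDecreasing {n : ℕ} (M : Finset (Finset (Fin n))) : Prop :=
  (∀ s ∈ M, ∀ t, t ⊆ s → t ∈ M) ∧
    ∀ s ∈ M, ∀ l ∈ s, ∀ k, k < l → k ∉ s → insert k (s.erase l) ∈ M

theorem IsDecreasing.lowerPart {n : ℕ} {M : Finset (Finset (Fin (n + 1)))} (hM : IsDecreasing M) :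
    IsDecreasing (lowerPart M) := by
  refine ⟨fun s hs t hts => ?_, fun s hs l hl k hkl hk => ?_⟩
  · rw [mem_lowerPart] at *
    exact hM.1 _ hs _ (Finset.map_subset_map.2 hts)
  · rw [mem_lowerPart] at *
    have := hM.2 _ hs l.castSucc (Finset.mem_map_of_mem Fin.castSuccEmb hl) k.castSucc
      (Fin.castSucc_lt_castSucc_iff.2 hkl) (by simpa using hk)
    rw [Finset.map_insert, Finset.map_erase]
    exact this

theorem IsDecreasing.upperPart {n : ℕ} {M : Finset (Finset (Fin (n + 1)))} (hM : IsDecreasing M) :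
    IsDecreasing (upperPart M) := by
  refine ⟨fun s hs t hts => ?_, fun s hs l hl k hkl hk => ?_⟩
  · rw [mem_upperPart] at *
    exact hM.1 _ hs _ (Finset.insert_subset_insert _ (Finset.map_subset_map.2 hts))
  · rw [mem_upperPart] at *
    have := hM.2 _ hs l.castSucc
      (Finset.mem_insert_of_mem (Finset.mem_map_of_mem Fin.castSuccEmb hl)) k.castSucc
      (Fin.castSucc_lt_castSucc_iff.2 hkl) (by simpa [Fin.castSucc_ne_last] using hk)
    rw [Finset.map_insert, Finset.map_erase, Finset.insert_comm]
    rwa [Finset.erase_insert_of_ne (Fin.castSucc_ne_last l).symm] at this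

theorem IsDecreasing.mem_lowerPart_of_upperPart {n : ℕ} {M : Finset (Finset (Fin (n + 1)))}
    (hM : IsDecreasing M) {s : Finset (Fin n)} (hs : s ∈ _root_.upperPart M) :
    s ∈ _root_.lowerPart M :=
  mem_lowerPart.2 (hM.1 _ (mem_upperPart.1 hs) _ (Finset.subset_insert _ _))

/-- The last variable is the largest, so it may be replaced by `x_k`; if `x_k` already divides the
cofactor, then `x_k² = x_k` as functions and only a divisor is needed. -/
theorem IsDecreasing.insert_mem_lowerPart {n : ℕ} {M : Finset (Finset (Fin (n + 1)))}
    (hM : IsDecreasing M) {s : Finset (Fin n)} (hs : s ∈ _root_.upperPart M) (k : Fin n) :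
    insert k s ∈ _root_.lowerPart M := by
  by_cases hk : k ∈ s
  · rw [Finset.insert_eq_self.2 hk]
    exact hM.mem_lowerPart_of_upperPart hs
  · have := hM.2 _ (mem_upperPart.1 hs) (Fin.last n) (Finset.mem_insert_self _ _) k.castSucc
      (Fin.castSucc_lt_last k) (by simpa [Fin.castSucc_ne_last] using hk)
    rw [Finset.erase_insert (last_notMem_map s)] at this
    rw [mem_lowerPart, Finset.map_insert]
    exact this

theorem mul_monomialEval {n : ℕ} (s : Finset (Fin n)) (k : Fin n) (x : Fin n → ZMod 2) :
    x k * monomialEval s x = monomialEval (insert k s) x := by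
  by_cases hk : k ∈ s
  · rw [Finset.insert_eq_self.2 hk, monomialEval, ← Finset.mul_prod_erase s x hk, ← mul_assoc]
    have : ∀ u : ZMod 2, u * u = u := by decide
    rw [this]
  · rw [monomialEval, monomialEval, Finset.prod_insert hk]

theorem var_mul_mem {n : ℕ} {M M' : Finset (Finset (Fin n))} (k : Fin n)
    (hM : ∀ s ∈ M, insert k s ∈ M') {h : (Fin n → ZMod 2) → ZMod 2} (hh : h ∈ evalCode M) :
    (fun x => x k * h x) ∈ evalCode M' := by
  have : evalCode M ≤ (evalCode M').comap
      (LinearMap.mulLeft (ZMod 2) (fun x : Fin n → ZMod 2 => x k)) := by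
    refine Submodule.span_le.2 ?_
    rintro _ ⟨s, hs, rfl⟩
    refine Submodule.subset_span ⟨_, hM s hs, ?_⟩
    ext x
    exact (mul_monomialEval s k x).symm
  exact this hh

/-- Decreasingness makes the count independent of the rest of `M`: `g` is a combination of `h` and
the products `x_k h`, and all of these have their monomials in the lower part. -/
theorem AffineOn.mem_lowerPart {n : ℕ} {M : Finset (Finset (Fin (n + 1)))} (hM : IsDecreasing M)
    {g h : (Fin n → ZMod 2) → ZMod 2} (hflat : SupportFlat h) (h0 : h ≠ 0)
    (hh : h ∈ evalCode (upperPart M)) (hg : AffineOn h g) : g ∈ evalCode (lowerPart M) := by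
  obtain ⟨e, L, hL⟩ := exists_affine_extension hflat h0 hg
  have : g = e • h + ∑ k, L (Pi.single k 1) • fun x => x k * h x := by
    ext x
    rw [hL, LinearMap.pi_apply_eq_sum_univ L x]
    simp only [Pi.add_apply, Pi.smul_apply, smul_eq_mul, Finset.sum_apply, mul_add,
      Finset.mul_sum]
    congr 1
    · ring
    · refine Finset.sum_congr rfl fun k _ => ?_
      have : (fun j => if k = j then (1 : ZMod 2) else 0) = Pi.single k 1 := by
        ext j
        simp [Pi.single_apply, eq_comm]
      rw [this]
      ring
  rw [this]
  refine Submodule.add_mem _ (Submodule.smul_mem _ _ (evalCode_mono ?_ hh))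
    (Submodule.sum_mem _ fun k _ => Submodule.smul_mem _ _ (var_mul_mem k ?_ hh))
  · exact fun s hs => hM.mem_lowerPart_of_upperPart hs
  · exact fun s hs => hM.insert_mem_lowerPart hs k

/-! ## The number of minimum weight words -/

/-- The exponent `D + |λ_s|`, `D = |s|`, for a monomial `s`. -/
def monomialExponent {n : ℕ} (s : Finset (Fin n)) : ℕ :=
  s.card + ((∑ l ∈ s, (l : ℕ)) - s.card * (s.card - 1) / 2)

/-- Counting from zero, the `m`-th smallest element is at least `m`. Hence the truncated subtraction
in the exponents is exact. -/
theorem triangle_le_sum {n : ℕ} (s : Finset (Fin n)) :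
    s.card * (s.card - 1) / 2 ≤ ∑ l ∈ s, (l : ℕ) := by
  rw [← Finset.sum_range_id, Finset.sum_range, ← Finset.sum_coe_sort s,
    ← (s.orderIsoOfFin rfl).toEquiv.sum_comp]
  refine Finset.sum_le_sum fun m _ => ?_
  have : StrictMono fun m : Fin s.card => ((s.orderEmbOfFin rfl m : Fin n) : ℕ) :=
    fun a b hab => (s.orderEmbOfFin rfl).strictMono hab
  obtain ⟨m, hm⟩ := m
  induction m with
  | zero => simp
  | succ m ih =>
    have hlt : (⟨m, by omega⟩ : Fin s.card) < ⟨m + 1, hm⟩ := by simp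
    exact Nat.succ_le_of_lt ((ih (by omega) (Finset.mem_univ _)).trans_lt (this hlt))

theorem monomialExponent_map {n : ℕ} (s : Finset (Fin n)) :
    monomialExponent (s.map Fin.castSuccEmb) = monomialExponent s := by
  simp [monomialExponent]

/-- Multiplying `s` by the last variable multiplies its count by `2^(n + 1 - s.card)`, which is the
number of affine functions on a flat of `2^(n - s.card)` points. -/
theorem monomialExponent_insert {n : ℕ} (s : Finset (Fin n)) :
    monomialExponent (insert (Fin.last n) (s.map Fin.castSuccEmb)) + s.card =
      n + 1 + monomialExponent s := by
  have h1 := triangle_le_sum s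
  have h2 := triangle_le_sum (insert (Fin.last n) (s.map Fin.castSuccEmb))
  rw [monomialExponent, monomialExponent]
  rw [card_insert_last, Finset.sum_insert (last_notMem_map s), Finset.sum_map] at *
  simp only [Fin.val_last, Fin.coe_castSuccEmb, Fin.val_castSucc] at *
  have : (s.card + 1) * (s.card + 1 - 1) / 2 = s.card * (s.card - 1) / 2 + s.card := by
    rw [← Finset.sum_range_id, ← Finset.sum_range_id, Finset.sum_range_succ]
  omega

theorem sum_finset_fin_succ {n : ℕ} (F : Finset (Fin (n + 1)) → ℕ) :
    ∑ s, F s = ∑ t : Finset (Fin n), F (t.map Fin.castSuccEmb) +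
      ∑ t : Finset (Fin n), F (insert (Fin.last n) (t.map Fin.castSuccEmb)) := by
  let φ : Finset (Fin n) ⊕ Finset (Fin n) → Finset (Fin (n + 1)) :=
    Sum.elim (fun t => t.map Fin.castSuccEmb) fun t => insert (Fin.last n) (t.map Fin.castSuccEmb)
  have hφ : Function.Bijective φ := by
    constructor
    · rintro (s | s) (t | t) h
      · exact congrArg Sum.inl (Finset.map_injective _ h)
      · have h' : s.map Fin.castSuccEmb = insert (Fin.last n) (t.map Fin.castSuccEmb) := h
        exact absurd (h' ▸ Finset.mem_insert_self _ _) (last_notMem_map s)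
      · have h' : insert (Fin.last n) (s.map Fin.castSuccEmb) = t.map Fin.castSuccEmb := h
        exact absurd (h' ▸ Finset.mem_insert_self _ _) (last_notMem_map t)
      · have := congrArg (fun u => u.erase (Fin.last n)) h
        simp only [φ, Sum.elim_inr, Finset.erase_insert (last_notMem_map _)] at this
        exact congrArg Sum.inr (Finset.map_injective _ this)
    · intro s
      obtain ⟨t, h | h⟩ := eq_map_or_eq_insert s
      · exact ⟨Sum.inl t, h.symm⟩
      · exact ⟨Sum.inr t, h.symm⟩
  rw [← (Equiv.ofBijective φ hφ).sum_comp, Fintype.sum_sum_type]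
  rfl

/-- For fixed `h ≠ 0` the condition on `g` no longer mentions `M`, so the words above each `h` can
be counted. -/
theorem joinLast_minWeight_iff {n q : ℕ} {M : Finset (Finset (Fin (n + 1)))}
    (hM : IsDecreasing M) (hdeg : ∀ s ∈ M, s.card ≤ q + 1) {g h : (Fin n → ZMod 2) → ZMod 2}
    (h0 : h ≠ 0) :
    (joinLast g h ∈ evalCode M ∧ hammingNorm (joinLast g h) * 2 ^ (q + 1) = 2 ^ (n + 1)) ↔
      (h ∈ evalCode (upperPart M) ∧ hammingNorm h * 2 ^ q = 2 ^ n) ∧ AffineOn h g := by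
  have hq : ∀ s ∈ upperPart M, s.card ≤ q := fun s hs =>
    Nat.le_of_succ_le_succ (card_lt_of_mem_upperPart hdeg s hs)
  constructor
  · rintro ⟨hf, hw⟩
    have hh := (joinLast_mem.1 hf).2
    obtain ⟨h1, h2⟩ := hammingNorm_upper_of_joinLast hq hh h0 hw
    exact ⟨⟨hh, h1⟩, AffineOn.of_supportFlat_joinLast (supportFlat_of_hammingNorm hq hh h1)
      ((hammingNorm_joinLast_eq_iff g h).1 h2) (supportFlat_of_hammingNorm hdeg hf hw)⟩
  · rintro ⟨⟨hh, hw⟩, hg⟩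
    refine ⟨joinLast_mem.2
      ⟨hg.mem_lowerPart hM (supportFlat_of_hammingNorm hq hh hw) h0 hh, hh⟩, ?_⟩
    rw [(hammingNorm_joinLast_eq_iff g h).2 hg.1, pow_succ, pow_succ, ← hw, mul_assoc]

open scoped Classical in
/-- In a decreasing monomial code of degree at most `r`, each monomial `s` of degree `r`
contributes `2 ^ (r + |λ_s|)` words of weight `2 ^ (n - r)`. -/
theorem card_minWeight_evalCode {n r : ℕ} {M : Finset (Finset (Fin n))} (hM : IsDecreasing M)
    (hdeg : ∀ s ∈ M, s.card ≤ r) :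
    (Finset.univ.filter fun f : (Fin n → ZMod 2) → ZMod 2 =>
        f ∈ evalCode M ∧ hammingNorm f * 2 ^ r = 2 ^ n).card =
      ∑ s, if s ∈ M ∧ s.card = r then 2 ^ monomialExponent s else 0 := by
  induction n generalizing r with
  | zero =>
    rw [Fintype.sum_unique]
    rcases r with _ | q
    · by_cases h : (default : Finset (Fin 0)) ∈ M
      · have hone : monomialEval (default : Finset (Fin 0)) = 1 := by
          ext x
          simp [monomialEval, Subsingleton.elim default (∅ : Finset (Fin 0))]
        have hmem : (1 : (Fin 0 → ZMod 2) → ZMod 2) ∈ evalCode M :=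
          Submodule.subset_span ⟨_, h, hone⟩
        rw [if_pos ⟨h, rfl⟩, Finset.card_eq_one.2 ⟨1, ?_⟩]
        · rfl
        ext f
        rw [Finset.mem_filter, Finset.mem_singleton]
        constructor
        · rintro ⟨-, -, hw⟩
          rcases zmod_two_cases (f default) with h1 | h1
          · have : f = 0 := funext fun x => by rw [Subsingleton.elim x default, h1]; rfl
            simp [this] at hw
          · exact funext fun x => by rw [Subsingleton.elim x default, h1]; rfl
        · rintro rfl
          refine ⟨Finset.mem_univ _, hmem, ?_⟩
          simp [hammingNorm]
      · have he : M = ∅ := Finset.eq_empty_of_forall_notMem fun s hs =>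
          h (Subsingleton.elim s default ▸ hs)
        rw [if_neg (fun hc => h hc.1), Finset.card_eq_zero, Finset.filter_eq_empty_iff]
        rintro f - ⟨hf, hw⟩
        have : f = 0 := by simpa [he, evalCode] using hf
        simp [this] at hw
    · rw [if_neg (fun hc => absurd hc.2 (by
        rw [Subsingleton.elim default (∅ : Finset (Fin 0))]; simp)), Finset.card_eq_zero,
        Finset.filter_eq_empty_iff]
      rintro f - ⟨-, hw⟩
      have := Nat.eq_one_of_mul_eq_one_left hw
      have := Nat.one_lt_two_pow q.succ_ne_zero
      omega
  | succ n ih =>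
    have hsplit : (Finset.univ.filter fun f : (Fin (n + 1) → ZMod 2) → ZMod 2 =>
        f ∈ evalCode M ∧ hammingNorm f * 2 ^ r = 2 ^ (n + 1)).card =
        ∑ h : (Fin n → ZMod 2) → ZMod 2, (Finset.univ.filter fun g =>
          joinLast g h ∈ evalCode M ∧ hammingNorm (joinLast g h) * 2 ^ r = 2 ^ (n + 1)).card := by
      simp only [Finset.card_filter]
      rw [← (joinEquiv n).toEquiv.sum_comp, Fintype.sum_prod_type_right]
      rfl
    -- Words without the last variable: weight and length both double, so `r` is unchanged.
    have hzero : (Finset.univ.filter fun g : (Fin n → ZMod 2) → ZMod 2 =>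
          joinLast g 0 ∈ evalCode M ∧
            hammingNorm (joinLast g 0) * 2 ^ r = 2 ^ (n + 1)).card =
        ∑ s, if s ∈ lowerPart M ∧ s.card = r then 2 ^ monomialExponent s else 0 := by
      rw [← ih hM.lowerPart (card_le_of_mem_lowerPart hdeg)]
      congr 1
      refine Finset.filter_congr fun g _ => ?_
      rw [joinLast_mem, hammingNorm_joinLast, add_zero, pow_succ]
      refine and_congr (and_iff_left (Submodule.zero_mem _)) ?_
      constructor <;> intro h <;> linarith
    rw [hsplit, Fintype.sum_eq_add_sum_compl 0, hzero, sum_finset_fin_succ]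
    simp only [mem_lowerPart, Finset.card_map, monomialExponent_map, card_insert_last]
    congr 1
    rcases r with _ | q
    · refine (Finset.sum_eq_zero fun h hh => ?_).trans (Finset.sum_eq_zero fun s _ => ?_).symm
      · rw [Finset.card_eq_zero, Finset.filter_eq_empty_iff]
        rintro g - ⟨hf, -⟩
        obtain ⟨q, hq, -⟩ := exists_eq_succ_of_mem_upperPart hdeg (joinLast_mem.1 hf).2
          (by simpa using hh)
        omega
      · rw [if_neg (fun hc => absurd hc.2 (Nat.succ_ne_zero _))]
    · have hq : ∀ s ∈ upperPart M, s.card ≤ q := fun s hs =>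
        Nat.le_of_succ_le_succ (card_lt_of_mem_upperPart hdeg s hs)
      -- Each admissible `h` has `2 * hammingNorm h = 2^(n + 1 - q)` choices of `g`; the factor `2 ^
      -- q` clears the subtraction.
      have hterm : ∀ h ∈ ({0}ᶜ : Finset ((Fin n → ZMod 2) → ZMod 2)),
          2 ^ q * (Finset.univ.filter fun g => joinLast g h ∈ evalCode M ∧
            hammingNorm (joinLast g h) * 2 ^ (q + 1) = 2 ^ (n + 1)).card =
          2 ^ (n + 1) * if h ∈ evalCode (upperPart M) ∧ hammingNorm h * 2 ^ q = 2 ^ n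
            then 1 else 0 := by
        intro h hh
        have h0 : h ≠ 0 := by simpa using hh
        simp only [joinLast_minWeight_iff hM hdeg h0]
        split_ifs with hc
        · simp only [hc, true_and, and_true]
          rw [← Fintype.card_subtype, ← Nat.card_eq_fintype_card,
            card_affineOn (supportFlat_of_hammingNorm hq hc.1 hc.2) h0, mul_one, pow_succ,
            ← hc.2]
          ring
        · simp [hc]
      refine Nat.eq_of_mul_eq_mul_left (show 0 < 2 ^ q by positivity) ?_
      rw [Finset.mul_sum, Finset.sum_congr rfl hterm, ← Finset.mul_sum]
      have hne : ∑ h ∈ ({0}ᶜ : Finset ((Fin n → ZMod 2) → ZMod 2)),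
          (if h ∈ evalCode (upperPart M) ∧ hammingNorm h * 2 ^ q = 2 ^ n then 1 else 0) =
          ∑ h, if h ∈ evalCode (upperPart M) ∧ hammingNorm h * 2 ^ q = 2 ^ n then 1 else 0 := by
        rw [Fintype.sum_eq_add_sum_compl 0, hammingNorm_zero, zero_mul,
          if_neg (fun h => absurd h.2 (by positivity)), zero_add]
      rw [hne, ← Finset.card_filter, ih hM.upperPart hq, Finset.mul_sum, Finset.mul_sum]
      refine Finset.sum_congr rfl fun s _ => ?_
      simp only [mem_upperPart, Nat.add_right_cancel_iff]
      split_ifs with hc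
      · rw [← pow_add, ← pow_add, ← monomialExponent_insert s, hc.2, add_comm]
      · simp

/-! ## Polar codes as evaluation codes -/

-- The kernel entry at `(b, c)` vanishes only for `b = 0`, `c = 1`, so the Kronecker power records
-- containment of binary digits. The last Kronecker factor governs digit 0.
open scoped Classical in
theorem polarMatrix_apply (n : ℕ) (i j : Fin (2 ^ n)) :
    polarMatrix n i j =
      if ∀ l, (j : ℕ).testBit l = true → (i : ℕ).testBit l = true then 1 else 0 := by
  induction n with
  | zero =>
    have : i = j := Fin.ext (by omega)
    subst this
    simp [polarMatrix]
  | succ n ih =>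
    obtain ⟨⟨i', b⟩, rfl⟩ := finProdFinEquiv.surjective i
    obtain ⟨⟨j', c⟩, rfl⟩ := finProdFinEquiv.surjective j
    have hsucc : ∀ (k : Fin (2 ^ n)) (d : Fin 2) (l : ℕ),
        ((finProdFinEquiv (k, d) : Fin (2 ^ n * 2)) : ℕ).testBit (l + 1) =
          (k : ℕ).testBit l := by
      intro k d l
      rw [finProdFinEquiv_apply_val, Nat.testBit_succ]
      dsimp only
      congr 1
      omega
    have hzero : ∀ (k : Fin (2 ^ n)) (d : Fin 2),
        ((finProdFinEquiv (k, d) : Fin (2 ^ n * 2)) : ℕ).testBit 0 = decide (d = 1) := by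
      intro k d
      rw [finProdFinEquiv_apply_val, Nat.testBit_zero]
      fin_cases d <;> simp
    have hentry : polarMatrix (n + 1) (finProdFinEquiv (i', b)) (finProdFinEquiv (j', c)) =
        polarMatrix n i' j' * polarKernel b c := by
      rw [polarMatrix, Matrix.reindex_apply, Matrix.submatrix_apply, Equiv.symm_apply_apply,
        Equiv.symm_apply_apply, Matrix.kroneckerMap_apply]
    have hall : (∀ l, ((finProdFinEquiv (j', c) : Fin (2 ^ n * 2)) : ℕ).testBit l = true →
        ((finProdFinEquiv (i', b) : Fin (2 ^ n * 2)) : ℕ).testBit l = true) ↔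
        (c = 1 → b = 1) ∧ ∀ l, (j' : ℕ).testBit l = true → (i' : ℕ).testBit l = true := by
      constructor
      · intro h
        refine ⟨fun hc => ?_, fun l => ?_⟩
        · have h0 := h 0
          rw [hzero, hzero, decide_eq_true_eq, decide_eq_true_eq] at h0
          exact h0 hc
        · simpa only [hsucc] using h (l + 1)
      · rintro ⟨h0, h1⟩ (_ | l)
        · rwa [hzero, hzero, decide_eq_true_eq, decide_eq_true_eq]
        · simpa only [hsucc] using h1 l
    have hker : ∀ b c : Fin 2, polarKernel b c = if c = 1 → b = 1 then 1 else 0 := by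
      intro b c
      fin_cases b <;> fin_cases c <;> simp [polarKernel]
    refine hentry.trans ?_
    rw [ih, hker]
    by_cases h1 : c = 1 → b = 1 <;>
      by_cases h2 : ∀ l, (j' : ℕ).testBit l = true → (i' : ℕ).testBit l = true
    · rw [if_pos h1, if_pos h2, if_pos (hall.2 ⟨h1, h2⟩), one_mul]
    · rw [if_neg h2, if_neg (fun h => h2 (hall.1 h).2), zero_mul]
    · rw [if_neg h1, if_neg (fun h => h1 (hall.1 h).1), mul_zero]
    · rw [if_neg h1, if_neg (fun h => h1 (hall.1 h).1), mul_zero]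

theorem eq_of_testBit_eq {n : ℕ} {i j : Fin (2 ^ n)}
    (h : ∀ l : Fin n, (i : ℕ).testBit l = (j : ℕ).testBit l) : i = j := by
  refine Fin.ext (Nat.eq_of_testBit_eq fun l => ?_)
  by_cases hl : l < n
  · exact h ⟨l, hl⟩
  · have hle : 2 ^ n ≤ 2 ^ l := Nat.pow_le_pow_right two_pos (not_lt.1 hl)
    rw [Nat.testBit_eq_false_of_lt (i.2.trans_le hle),
      Nat.testBit_eq_false_of_lt (j.2.trans_le hle)]

theorem polarMonomial_bijective (n : ℕ) :
    Function.Bijective (polarMonomial : Fin (2 ^ n) → Finset (Fin n)) := by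
  rw [Fintype.bijective_iff_injective_and_card]
  refine ⟨fun i j h => eq_of_testBit_eq fun l => ?_, by simp⟩
  have := Finset.ext_iff.1 h l
  simp only [polarMonomial, Finset.mem_filter, Finset.mem_univ, true_and] at this
  revert this
  cases (i : ℕ).testBit l <;> cases (j : ℕ).testBit l <;> simp

/-- The evaluation point of column `j`: `x_l = 1` if and only if the `l`-th digit of `j` is `0`. -/
def bitPoint {n : ℕ} (j : Fin (2 ^ n)) (l : Fin n) : ZMod 2 :=
  if (j : ℕ).testBit l = true then 0 else 1

theorem bitPoint_bijective (n : ℕ) :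
    Function.Bijective (bitPoint : Fin (2 ^ n) → Fin n → ZMod 2) := by
  rw [Fintype.bijective_iff_injective_and_card]
  refine ⟨fun i j h => eq_of_testBit_eq fun l => ?_, by simp⟩
  have := congrFun h l
  simp only [bitPoint] at this
  revert this
  cases (i : ℕ).testBit l <;> cases (j : ℕ).testBit l <;> simp

/-- Row `i` of the matrix is the evaluation of `f_i`: the product vanishes exactly when some digit
is 0 in `i` and 1 in `j`. -/
theorem monomialEval_bitPoint {n : ℕ} (i j : Fin (2 ^ n)) :
    monomialEval (polarMonomial i) (bitPoint j) = polarMatrix n i j := by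
  rw [polarMatrix_apply, monomialEval]
  split_ifs with h
  · refine Finset.prod_eq_one fun l hl => ?_
    have hl' : (i : ℕ).testBit l = false := (Finset.mem_filter.1 hl).2
    refine if_neg fun hj => ?_
    rw [h l hj] at hl'
    exact absurd hl' (by decide)
  · push Not at h
    obtain ⟨l, hj, hi⟩ := h
    have hl : l < n := by
      by_contra hl
      rw [Nat.testBit_eq_false_of_lt
        (j.2.trans_le (Nat.pow_le_pow_right two_pos (not_lt.1 hl)))] at hj
      exact absurd hj (by decide)
    refine Finset.prod_eq_zero (i := ⟨l, hl⟩) ?_ (if_pos hj)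
    exact Finset.mem_filter.2 ⟨Finset.mem_univ _, by simpa using hi⟩

theorem comp_bitPoint_mem_polarCode {n : ℕ} {A : Finset (Fin (2 ^ n))}
    {f : (Fin n → ZMod 2) → ZMod 2} (hf : f ∈ evalCode (A.image polarMonomial)) :
    f ∘ bitPoint ∈ polarCode A := by
  induction hf using Submodule.span_induction with
  | mem f hf =>
    obtain ⟨s, hs, rfl⟩ := hf
    obtain ⟨i, hi, rfl⟩ := Finset.mem_image.1 (Finset.mem_coe.1 hs)
    refine ⟨Pi.single i 1, fun k hk => Pi.single_eq_of_ne (M := fun _ => ZMod 2) ?_ 1, ?_⟩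
    · rintro rfl
      exact hk hi
    ext j
    rw [Matrix.single_one_vecMul]
    exact monomialEval_bitPoint i j
  | zero => exact ⟨0, fun _ _ => rfl, by rw [Matrix.zero_vecMul]; rfl⟩
  | add f g _ _ hf hg =>
    obtain ⟨u, hu, hfu⟩ := hf
    obtain ⟨v, hv, hgv⟩ := hg
    refine ⟨u + v, fun k hk => by simp [hu k hk, hv k hk], ?_⟩
    rw [Matrix.add_vecMul, ← hfu, ← hgv]
    rfl
  | smul c f _ hf =>
    obtain ⟨u, hu, hfu⟩ := hf
    refine ⟨c • u, fun k hk => by simp [hu k hk], ?_⟩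
    rw [Matrix.smul_vecMul, ← hfu]
    rfl

theorem exists_of_mem_polarCode {n : ℕ} {A : Finset (Fin (2 ^ n))} {c : Fin (2 ^ n) → ZMod 2}
    (hc : c ∈ polarCode A) : ∃ f ∈ evalCode (A.image polarMonomial), c = f ∘ bitPoint := by
  obtain ⟨u, hu, rfl⟩ := hc
  refine ⟨∑ i, u i • monomialEval (polarMonomial i), Submodule.sum_mem _ fun i _ => ?_, ?_⟩
  · by_cases hi : i ∈ A
    · exact Submodule.smul_mem _ _ (Submodule.subset_span
        ⟨_, Finset.mem_coe.2 (Finset.mem_image_of_mem _ hi), rfl⟩)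
    · rw [hu i hi, zero_smul]
      exact Submodule.zero_mem _
  · ext j
    simp [Matrix.vecMul, dotProduct, monomialEval_bitPoint]

theorem hammingNorm_comp_bitPoint {n : ℕ} (f : (Fin n → ZMod 2) → ZMod 2) :
    hammingNorm (f ∘ bitPoint : Fin (2 ^ n) → ZMod 2) = hammingNorm f := by
  rw [hammingNorm_eq_sum, hammingNorm_eq_sum]
  exact (Equiv.ofBijective _ (bitPoint_bijective n)).sum_comp fun x => (f x).val

/-! ## The order of monomials -/

theorem card_filter_lt_orderEmbOfFin {n : ℕ} (t : Finset (Fin n)) {k : ℕ} (h : t.card = k)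
    (m : Fin k) : (t.filter fun x => x < t.orderEmbOfFin h m).card = m := by
  have : t.filter (fun x => x < t.orderEmbOfFin h m) =
      (Finset.Iio m).map (t.orderEmbOfFin h).toEmbedding := by
    ext x
    simp only [Finset.mem_filter, Finset.mem_map, Finset.mem_Iio, RelEmbedding.coe_toEmbedding]
    constructor
    · rintro ⟨hx, hlt⟩
      have : x ∈ Set.range (t.orderEmbOfFin h) := by
        rw [Finset.range_orderEmbOfFin]
        exact hx
      obtain ⟨a, rfl⟩ := this
      exact ⟨a, (t.orderEmbOfFin h).lt_iff_lt.1 hlt, rfl⟩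
    · rintro ⟨a, ha, rfl⟩
      exact ⟨t.orderEmbOfFin_mem h a, (t.orderEmbOfFin h).lt_iff_lt.2 ha⟩
  rw [this, Finset.card_map, Fin.card_Iio]

theorem monomialLESame_refl {n : ℕ} (s : Finset (Fin n)) : MonomialLESame s s :=
  ⟨rfl, fun _ => le_rfl⟩

/-- Replacing a variable of `s` by a smaller one gives a smaller monomial. -/
theorem monomialLESame_exchange {n : ℕ} {s : Finset (Fin n)} {k l : Fin n} (hl : l ∈ s)
    (hkl : k < l) (hk : k ∉ s) : MonomialLESame (insert k (s.erase l)) s := by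
  have hcard : (insert k (s.erase l)).card = s.card := by
    rw [Finset.card_insert_of_notMem (fun h => hk (Finset.mem_of_mem_erase h)),
      Finset.card_erase_add_one hl]
  refine ⟨hcard, fun m => ?_⟩
  by_contra hlt
  rw [not_le] at hlt
  set t := insert k (s.erase l)
  have h1 := card_filter_lt_orderEmbOfFin t hcard m
  have h2 := card_filter_lt_orderEmbOfFin s rfl m
  set a := s.orderEmbOfFin rfl m with ha
  set b := t.orderEmbOfFin hcard m
  have has : a ∈ s := s.orderEmbOfFin_mem rfl m
  have h3 : (s.filter fun x => x ≤ a).card = m + 1 := by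
    rw [← h2, ← Finset.card_insert_of_notMem (s := s.filter fun x => x < a) (a := a) (by simp)]
    congr 1
    ext x
    simp only [Finset.mem_filter, Finset.mem_insert, le_iff_lt_or_eq]
    constructor
    · rintro ⟨hx, h | h⟩
      · exact Or.inr ⟨hx, h⟩
      · exact Or.inl h
    · rintro (rfl | ⟨hx, h⟩)
      · exact ⟨has, Or.inr rfl⟩
      · exact ⟨hx, Or.inl h⟩
  -- Sending `l` to `k` and fixing the rest injects the `m + 1` elements of `s` up to `a` into the
  -- elements of `t` below `b`, of which there are only `m`.
  have h4 : (s.filter fun x => x ≤ a).card ≤ (t.filter fun x => x < b).card := by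
    refine Finset.card_le_card_of_injOn (fun x => if x = l then k else x) ?_ ?_
    · intro x hx
      have hx' := Finset.mem_filter.1 (Finset.mem_coe.1 hx)
      refine Finset.mem_coe.2 (Finset.mem_filter.2 ?_)
      by_cases he : x = l
      · simp only [if_pos he]
        exact ⟨Finset.mem_insert_self _ _, (hkl.trans_le (he ▸ hx'.2)).trans hlt⟩
      · simp only [if_neg he]
        exact ⟨Finset.mem_insert_of_mem (Finset.mem_erase.2 ⟨he, hx'.1⟩), hx'.2.trans_lt hlt⟩
    · intro x hx y hy hxy
      have hx' := (Finset.mem_filter.1 (Finset.mem_coe.1 hx)).1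
      have hy' := (Finset.mem_filter.1 (Finset.mem_coe.1 hy)).1
      simp only at hxy
      split_ifs at hxy with e1 e2 e2
      · exact e1.trans e2.symm
      · exact absurd (hxy ▸ hy') hk
      · exact absurd (hxy ▸ hx') hk
      · exact hxy
  omega

theorem isDecreasing_of_isPolarInfoSet {n K : ℕ} {A : Finset (Fin (2 ^ n))}
    (hA : IsPolarInfoSet n K A) : IsDecreasing (A.image polarMonomial) := by
  have key : ∀ s ∈ A.image polarMonomial, ∀ t, MonomialLE t s → t ∈ A.image polarMonomial := by
    intro s hs t hts
    obtain ⟨j, hj, rfl⟩ := Finset.mem_image.1 hs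
    obtain ⟨i, rfl⟩ := (polarMonomial_bijective n).2 t
    exact Finset.mem_image_of_mem _ (hA.2 i j hts hj)
  refine ⟨fun s hs t hts => key s hs t ?_, fun s hs l hl k hkl hk => key s hs _ ?_⟩
  · by_cases hc : t.card = s.card
    · rw [Finset.eq_of_subset_of_card_le hts hc.ge]
      exact Or.inl (monomialLESame_refl s)
    · exact Or.inr ⟨hc, t, hts, monomialLESame_refl t⟩
  · exact Or.inl (monomialLESame_exchange hl hkl hk)

theorem sum_polarMonomial_of_eq {n : ℕ} {i : Fin (2 ^ n)} {k : ℕ}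
    (h : (polarMonomial i).card = k) :
    ∑ l ∈ polarMonomial i, (l : ℕ) =
      ∑ m : Fin k, (((polarMonomial i).orderEmbOfFin h m : Fin n) : ℕ) := by
  rw [← Finset.sum_coe_sort, ← ((polarMonomial i).orderIsoOfFin h).toEquiv.sum_comp]
  rfl

/-- On monomials of equal degree, `⪯` refines the order by the partial counts. -/
theorem partialCount_lt_of_monomialLESame {n : ℕ} {i j : Fin (2 ^ n)}
    (h : MonomialLESame (polarMonomial i) (polarMonomial j)) (hij : i ≠ j) :
    partialCount i < partialCount j := by
  obtain ⟨hcard, hle⟩ := h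
  have h1 := triangle_le_sum (polarMonomial i)
  have h2 := triangle_le_sum (polarMonomial j)
  have hsum : ∑ l ∈ polarMonomial i, (l : ℕ) < ∑ l ∈ polarMonomial j, (l : ℕ) := by
    rw [sum_polarMonomial_of_eq hcard, sum_polarMonomial_of_eq (i := j) rfl]
    have hle' : ∀ m ∈ Finset.univ, (((polarMonomial i).orderEmbOfFin hcard m : Fin n) : ℕ) ≤
        (((polarMonomial j).orderEmbOfFin rfl m : Fin n) : ℕ) := fun m _ => hle m
    refine lt_of_le_of_ne (Finset.sum_le_sum hle') fun he => hij ?_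
    rw [Finset.sum_eq_sum_iff_of_le hle'] at he
    have hfun : ⇑((polarMonomial i).orderEmbOfFin hcard) =
        ⇑((polarMonomial j).orderEmbOfFin rfl) :=
      funext fun m => Fin.ext (he m (Finset.mem_univ m))
    have hr := congrArg Set.range hfun
    rw [Finset.range_orderEmbOfFin, Finset.range_orderEmbOfFin, Finset.coe_inj] at hr
    exact (polarMonomial_bijective n).1 hr
  refine Nat.pow_lt_pow_right one_lt_two ?_
  rw [lambdaCard, lambdaCard]
  rw [hcard] at h1 ⊢
  omega

/-! ## Minimum weights of polar codes -/

theorem sum_partialCount_eq {n r : ℕ} (A : Finset (Fin (2 ^ n))) :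
    ∑ i ∈ A.filter (fun i => (polarMonomial i).card = r), partialCount i =
      ∑ s, if s ∈ A.image polarMonomial ∧ s.card = r then 2 ^ monomialExponent s else 0 := by
  rw [← (Equiv.ofBijective _ (polarMonomial_bijective n)).sum_comp, Finset.sum_filter,
    ← Finset.sum_filter_add_sum_filter_not Finset.univ (fun i => i ∈ A),
    Finset.sum_eq_zero (s := Finset.univ.filter fun i => i ∉ A), add_zero,
    Finset.filter_mem_eq_inter, Finset.univ_inter]
  · refine Finset.sum_congr rfl fun i hi => ?_
    simp only [Equiv.ofBijective_apply, Finset.mem_image_of_mem polarMonomial hi, true_and]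
    rfl
  · intro i hi
    refine if_neg fun h => (Finset.mem_filter.1 hi).2 ?_
    obtain ⟨j, hj, hji⟩ := Finset.mem_image.1 h.1
    exact (polarMonomial_bijective n).1 hji ▸ hj

theorem weightCount_polarCode {n K r w : ℕ} {A : Finset (Fin (2 ^ n))}
    (hA : IsPolarInfoSet n K A) (hdeg : ∀ i ∈ A, (polarMonomial i).card ≤ r)
    (hw : w * 2 ^ r = 2 ^ n) :
    weightCount (polarCode A) w =
      ∑ i ∈ A.filter (fun i => (polarMonomial i).card = r), partialCount i := by
  classical
  rw [sum_partialCount_eq, ← card_minWeight_evalCode (isDecreasing_of_isPolarInfoSet hA)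
    (by simpa using hdeg), weightCount, ← Set.ncard_coe_finset]
  have hinj : Function.Injective
      fun f : (Fin n → ZMod 2) → ZMod 2 => f ∘ (bitPoint : Fin (2 ^ n) → _) :=
    (bitPoint_bijective n).2.injective_comp_right
  rw [← Set.ncard_image_of_injective _ hinj]
  congr 1
  have hiff : ∀ v : ℕ, v = w ↔ v * 2 ^ r = 2 ^ n := fun v =>
    ⟨fun e => e ▸ hw, fun e => Nat.eq_of_mul_eq_mul_right (by positivity) (e.trans hw.symm)⟩
  ext c
  simp only [Set.mem_ofPred_eq, Set.mem_image, Finset.coe_filter, Finset.mem_univ, true_and, hiff]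
  constructor
  · rintro ⟨hc, hcw⟩
    obtain ⟨f, hf, rfl⟩ := exists_of_mem_polarCode hc
    rw [hammingNorm_comp_bitPoint] at hcw
    exact ⟨f, ⟨hf, hcw⟩, rfl⟩
  · rintro ⟨f, ⟨hf, hfw⟩, rfl⟩
    exact ⟨comp_bitPoint_mem_polarCode hf, by rwa [hammingNorm_comp_bitPoint]⟩

/-- The Reed-Muller bound is attained because the count of words of that weight is a nonempty sum of
powers of two. -/
theorem minWeight_polarCode {n K r : ℕ} {A : Finset (Fin (2 ^ n))}
    (hA : IsPolarInfoSet n K A) (hdeg : ∀ i ∈ A, (polarMonomial i).card ≤ r)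
    (hmax : ∃ i ∈ A, (polarMonomial i).card = r) :
    minWeight (polarCode A) * 2 ^ r = 2 ^ n := by
  obtain ⟨i, hi, hir⟩ := hmax
  have hrn : r ≤ n := by
    rw [← hir]
    simpa using (polarMonomial i).card_le_univ
  have hw : 2 ^ (n - r) * 2 ^ r = 2 ^ n := by rw [← pow_add, Nat.sub_add_cancel hrn]
  suffices h : minWeight (polarCode A) = 2 ^ (n - r) by rw [h, hw]
  have hpos : 0 < weightCount (polarCode A) (2 ^ (n - r)) := by
    rw [weightCount_polarCode hA hdeg hw]
    exact Finset.sum_pos (fun _ _ => Nat.two_pow_pos _) ⟨i, Finset.mem_filter.2 ⟨hi, hir⟩⟩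
  obtain ⟨c, hc, hcw⟩ := Set.nonempty_of_ncard_ne_zero hpos.ne'
  refine IsLeast.csInf_eq ⟨⟨c, hc, ?_, hcw⟩, ?_⟩
  · rintro rfl
    rw [hammingNorm_zero] at hcw
    exact absurd hcw.symm (by positivity)
  · rintro _ ⟨c, hc, h0, rfl⟩
    obtain ⟨f, hf, rfl⟩ := exists_of_mem_polarCode hc
    have hf0 : f ≠ 0 := fun e => h0 (by rw [e]; rfl)
    have := two_pow_le_hammingNorm (r := r) (by simpa using hdeg) hf hf0
    rw [hammingNorm_comp_bitPoint]
    rw [← hw] at this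
    exact Nat.le_of_mul_le_mul_right this (by positivity)

theorem minWeightCount_polarCode {n K r : ℕ} {A : Finset (Fin (2 ^ n))}
    (hA : IsPolarInfoSet n K A) (hdeg : ∀ i ∈ A, (polarMonomial i).card ≤ r)
    (hmax : ∃ i ∈ A, (polarMonomial i).card = r) :
    minWeightCount (polarCode A) =
      ∑ i ∈ A.filter (fun i => (polarMonomial i).card = r), partialCount i :=
  weightCount_polarCode hA hdeg (minWeight_polarCode hA hdeg hmax)

theorem exists_max_degree {n : ℕ} {A : Finset (Fin (2 ^ n))} (hA : A.Nonempty) :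
    ∃ r, (∀ i ∈ A, (polarMonomial i).card ≤ r) ∧ ∃ i ∈ A, (polarMonomial i).card = r := by
  obtain ⟨i, hi, h⟩ := A.exists_max_image (fun i => (polarMonomial i).card) hA
  exact ⟨_, h, i, hi, rfl⟩

/-! ## The MWD sequence -/

/-- The tie-breaking rule leaves no trace here: indices of equal degree and equal `A_i` contribute
equally and are incomparable when distinct. -/
theorem mwdBlock_spec {n : ℕ} (T : Finset (Fin (2 ^ n))) :
    (mwdBlock T).Nodup ∧ (∀ i, i ∈ mwdBlock T ↔ i ∈ T) ∧
      (mwdBlock T).Pairwise fun i j => partialCount i ≤ partialCount j := by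
  induction T using Finset.strongInduction with
  | H T ih =>
    rw [mwdBlock]
    split_ifs with hT
    · obtain ⟨h1, h2, h3⟩ := ih _ (Finset.erase_ssubset (mwdPick_mem T hT))
      refine ⟨List.nodup_cons.2 ⟨fun h => ?_, h1⟩, fun i => ?_, List.pairwise_cons.2 ⟨?_, h3⟩⟩
      · exact Finset.notMem_erase _ _ ((h2 _).1 h)
      · rw [List.mem_cons, h2, Finset.mem_erase]
        by_cases hi : i = mwdPick T hT
        · simp [hi, mwdPick_mem T hT]
        · simp [hi]
      · intro j hj
        exact (Finset.mem_filter.1 (Finset.max'_mem _ (argminCount_nonempty hT))).2 j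
          (Finset.mem_of_mem_erase ((h2 j).1 hj))
    · rw [Finset.not_nonempty_iff_eq_empty] at hT
      simp [hT]

theorem mem_mwdBlock_degreeBlock {n r : ℕ} {i : Fin (2 ^ n)} :
    i ∈ mwdBlock (degreeBlock n r) ↔ (polarMonomial i).card = r := by
  rw [(mwdBlock_spec _).2.1]
  simp [degreeBlock]

theorem mem_mwdSeq {n : ℕ} (i : Fin (2 ^ n)) : i ∈ mwdSeq n := by
  have : (polarMonomial i).card ≤ n := by simpa using (polarMonomial i).card_le_univ
  refine List.mem_flatMap.2 ⟨_, List.mem_range.2 (Nat.lt_succ_of_le this), ?_⟩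
  exact mem_mwdBlock_degreeBlock.2 rfl

theorem nodup_mwdSeq (n : ℕ) : (mwdSeq n).Nodup := by
  refine List.pairwise_flatMap.2 ⟨fun r _ => (mwdBlock_spec _).1, ?_⟩
  refine List.pairwise_lt_range.imp fun {a b} hab x hx y hy hxy => ?_
  rw [mem_mwdBlock_degreeBlock] at hx hy
  subst hxy
  omega

theorem pairwise_mwdSeq (n : ℕ) : (mwdSeq n).Pairwise fun i j =>
    (polarMonomial i).card < (polarMonomial j).card ∨
      ((polarMonomial i).card = (polarMonomial j).card ∧ partialCount i ≤ partialCount j) := by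
  refine List.pairwise_flatMap.2 ⟨fun r _ => ?_, ?_⟩
  · refine (mwdBlock_spec _).2.2.imp_of_mem fun {a b} ha hb hab => Or.inr ⟨?_, hab⟩
    rw [mem_mwdBlock_degreeBlock] at ha hb
    rw [ha, hb]
  · refine List.pairwise_lt_range.imp fun {a b} hab x hx y hy => Or.inl ?_
    rw [mem_mwdBlock_degreeBlock] at hx hy
    omega

theorem length_mwdSeq (n : ℕ) : (mwdSeq n).length = 2 ^ n := by
  rw [← List.toFinset_card_of_nodup (nodup_mwdSeq n),
    Finset.eq_univ_of_forall fun i => List.mem_toFinset.2 (mem_mwdSeq i)]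
  simp

theorem card_mwdInfoSet {n K : ℕ} (hK : K ≤ 2 ^ n) : (mwdInfoSet n K).card = K := by
  rw [mwdInfoSet, List.toFinset_card_of_nodup ((nodup_mwdSeq n).sublist (List.take_sublist _ _)),
    List.length_take, length_mwdSeq, min_eq_left hK]

theorem mwdInfoSet_before {n K : ℕ} {i j : Fin (2 ^ n)} (hi : i ∈ mwdInfoSet n K)
    (hj : j ∉ mwdInfoSet n K) : (polarMonomial i).card < (polarMonomial j).card ∨
      ((polarMonomial i).card = (polarMonomial j).card ∧ partialCount i ≤ partialCount j) := by
  rw [mwdInfoSet, List.mem_toFinset] at hi hj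
  have hs := pairwise_mwdSeq n
  have hm := mem_mwdSeq j
  rw [← List.take_append_drop K (mwdSeq n)] at hs hm
  exact (List.pairwise_append.1 hs).2.2 i hi j ((List.mem_append.1 hm).resolve_left hj)

/-- A missing `i` below a chosen `j` would come no earlier than `j` in degree and then in `A_i`,
whereas `⪯` between distinct monomials strictly lowers one of the two. -/
theorem isPolarInfoSet_mwdInfoSet {n K : ℕ} (hK : K ≤ 2 ^ n) :
    IsPolarInfoSet n K (mwdInfoSet n K) := by
  refine ⟨card_mwdInfoSet hK, fun i j hij hj => ?_⟩
  by_contra hi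
  have hb := mwdInfoSet_before hj hi
  rcases hij with h | ⟨hne, t, ht, hcard, -⟩
  · have hlt := partialCount_lt_of_monomialLESame h (fun e => hi (e ▸ hj))
    have := h.1
    omega
  · have := Finset.card_le_card ht
    omega

/-! ## Optimality -/

/-- The common part cancels. The largest weight in `D \ D'` then separates the two remainders, and
`D \ D'` has no more elements than `D' \ D`. -/
theorem sum_le_sum_of_initial {α : Type*} [DecidableEq α] {D D' : Finset α} {w : α → ℕ}
    (hcard : D.card ≤ D'.card) (hw : ∀ i ∈ D, ∀ j ∈ D', j ∉ D → w i ≤ w j) :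
    ∑ i ∈ D, w i ≤ ∑ i ∈ D', w i := by
  have h1 := Finset.card_sdiff_add_card_inter D D'
  have h2 := Finset.card_sdiff_add_card_inter D' D
  rw [Finset.inter_comm] at h2
  rw [← Finset.sum_inter_add_sum_sdiff D D', ← Finset.sum_inter_add_sum_sdiff D' D,
    Finset.inter_comm D' D]
  refine Nat.add_le_add_left ?_ _
  rcases (D \ D').eq_empty_or_nonempty with he | hne
  · rw [he, Finset.sum_empty]
    exact Nat.zero_le _
  obtain ⟨m, hm, hmax⟩ := (D \ D').exists_max_image w hne
  calc ∑ i ∈ D \ D', w i ≤ (D \ D').card • w m := Finset.sum_le_card_nsmul _ _ _ hmax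
    _ ≤ (D' \ D).card • w m := by
      rw [smul_eq_mul, smul_eq_mul]
      exact Nat.mul_le_mul_right _ (by omega)
    _ ≤ ∑ i ∈ D' \ D, w i := by
      refine Finset.card_nsmul_le_sum _ _ _ fun j hj => ?_
      rw [Finset.mem_sdiff] at hj
      exact hw m (Finset.mem_sdiff.1 hm).1 j hj.1 hj.2

theorem mwdInfoSet_optimal {n K : ℕ} (hK : 1 ≤ K) (hKN : K ≤ 2 ^ n) {A' : Finset (Fin (2 ^ n))}
    (hA' : IsPolarInfoSet n K A') :
    minWeight (polarCode A') ≤ minWeight (polarCode (mwdInfoSet n K)) ∧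
      (minWeight (polarCode A') = minWeight (polarCode (mwdInfoSet n K)) →
        minWeightCount (polarCode (mwdInfoSet n K)) ≤ minWeightCount (polarCode A')) := by
  have hA := isPolarInfoSet_mwdInfoSet hKN
  have hcard := hA.1
  have hcard' := hA'.1
  obtain ⟨r, hdeg, hmax⟩ := exists_max_degree (A := mwdInfoSet n K)
    (Finset.card_pos.1 (hK.trans_eq hcard.symm))
  obtain ⟨r', hdeg', hmax'⟩ := exists_max_degree (A := A') (Finset.card_pos.1 (hK.trans_eq hcard'.symm))
  -- Once an index of degree `r` is chosen, all lower degrees are exhausted.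
  have hlow : ∀ j : Fin (2 ^ n), (polarMonomial j).card < r → j ∈ mwdInfoSet n K := by
    intro j hj
    by_contra hjA
    obtain ⟨i, hi, hir⟩ := hmax
    have := mwdInfoSet_before hi hjA
    omega
  -- Otherwise `A'` has only monomials of degree below `r`, hence is a proper subset of a set of the
  -- same size.
  have hrr : r ≤ r' := by
    by_contra hlt
    obtain ⟨i, hi, hir⟩ := hmax
    have hss : A' ⊂ mwdInfoSet n K := by
      refine Finset.ssubset_iff_subset_ne.2 ⟨fun j hj => hlow j ?_, fun e => ?_⟩
      · have := hdeg' j hj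
        omega
      · have := hdeg' i (e ▸ hi)
        omega
    have := Finset.card_lt_card hss
    omega
  have hw := minWeight_polarCode hA hdeg hmax
  have hw' := minWeight_polarCode hA' hdeg' hmax'
  have hpow : 2 ^ r ≤ 2 ^ r' := Nat.pow_le_pow_right two_pos hrr
  refine ⟨?_, fun heq => ?_⟩
  · refine Nat.le_of_mul_le_mul_right ?_ (Nat.two_pow_pos r)
    exact (Nat.mul_le_mul_left _ hpow).trans_eq (hw'.trans hw.symm)
  · have hr : r = r' := by
      rw [heq] at hw'
      have hpos : 0 < minWeight (polarCode (mwdInfoSet n K)) := by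
        rw [Nat.pos_iff_ne_zero]
        intro h0
        rw [h0, zero_mul] at hw
        exact absurd hw.symm (by positivity)
      exact (Nat.pow_right_injective le_rfl (Nat.eq_of_mul_eq_mul_left hpos
        (hw'.trans hw.symm))).symm
    subst hr
    rw [minWeightCount_polarCode hA hdeg hmax, minWeightCount_polarCode hA' hdeg' hmax']
    refine sum_le_sum_of_initial ?_ fun i hi j hj hjD => ?_
    · have h1 := Finset.card_filter_add_card_filter_not (s := mwdInfoSet n K)
        (fun i => (polarMonomial i).card = r)
      have h2 := Finset.card_filter_add_card_filter_not (s := A')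
        (fun i => (polarMonomial i).card = r)
      -- `A'` cannot have more monomials of degree below `r` than the MWD set, which has them all;
      -- so it has at least as many of degree `r`.
      have h3 : (A'.filter fun i => ¬(polarMonomial i).card = r).card ≤
          ((mwdInfoSet n K).filter fun i => ¬(polarMonomial i).card = r).card := by
        refine Finset.card_le_card fun j hj => ?_
        rw [Finset.mem_filter] at hj ⊢
        exact ⟨hlow j (lt_of_le_of_ne (hdeg' j hj.1) hj.2), hj.2⟩
      omega
    · rw [Finset.mem_filter] at hi hj hjD
      have := mwdInfoSet_before hi.1 (fun h => hjD ⟨h, hj.2⟩)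
      omega

/-! ## The Gaussian tail -/

theorem integrableOn_gaussian (x : ℝ) :
    MeasureTheory.IntegrableOn (fun t : ℝ => Real.exp (-t ^ 2 / 2)) (Set.Ioi x) := by
  have := (integrable_exp_neg_mul_sq (b := 1 / 2) (by norm_num)).integrableOn (s := Set.Ioi x)
  refine this.congr_fun (fun t _ => ?_) measurableSet_Ioi
  ring_nf

theorem gaussianQ_nonneg (x : ℝ) : 0 ≤ gaussianQ x :=
  mul_nonneg (by positivity) (MeasureTheory.setIntegral_nonneg measurableSet_Ioi
    fun _ _ => (Real.exp_pos _).le)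

/-- After translating by `δ`, the exponent satisfies `(t + δ)² / 2 ≥ t² / 2 + x δ` for `t > x`. -/
theorem gaussianQ_add_le {x δ : ℝ} (hδ : 0 ≤ δ) :
    gaussianQ (x + δ) ≤ Real.exp (-(x * δ)) * gaussianQ x := by
  have h : ∫ t in Set.Ioi (x + δ), Real.exp (-t ^ 2 / 2) =
      ∫ t in Set.Ioi x, Real.exp (-(t + δ) ^ 2 / 2) := by
    have := (MeasureTheory.measurePreserving_add_right MeasureTheory.volume δ
      ).setIntegral_preimage_emb (measurableEmbedding_addRight δ)
      (fun t : ℝ => Real.exp (-t ^ 2 / 2)) (Set.Ioi (x + δ))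
    rw [Set.preimage_add_const_Ioi, add_sub_cancel_right] at this
    exact this.symm
  have hle : ∫ t in Set.Ioi x, Real.exp (-(t + δ) ^ 2 / 2) ≤
      ∫ t in Set.Ioi x, Real.exp (-(x * δ)) * Real.exp (-t ^ 2 / 2) := by
    refine MeasureTheory.integral_mono_of_nonneg (Filter.Eventually.of_forall fun t =>
      (Real.exp_pos _).le) ((integrableOn_gaussian x).const_mul _) ?_
    filter_upwards [MeasureTheory.ae_restrict_mem measurableSet_Ioi] with t ht
    rw [← Real.exp_add, Real.exp_le_exp]
    have := mul_le_mul_of_nonneg_right (le_of_lt (Set.mem_Ioi.1 ht)) hδ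
    nlinarith [sq_nonneg δ]
  rw [gaussianQ, gaussianQ, h, mul_left_comm]
  refine mul_le_mul_of_nonneg_left (hle.trans_eq ?_) (by positivity)
  rw [MeasureTheory.integral_const_mul]

/-- Of two bounds `a Q(√(c γ))`, the one with the larger `c` wins at high SNR. -/
theorem eventually_gaussianQ_le {c c' a : ℝ} (hc' : 0 < c') (hc : c' < c) :
    ∀ᶠ γ : ℝ in Filter.atTop, a * gaussianQ (Real.sqrt (c * γ)) ≤
      gaussianQ (Real.sqrt (c' * γ)) := by
  have hs : 0 < Real.sqrt c' * (Real.sqrt c - Real.sqrt c') :=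
    mul_pos (Real.sqrt_pos.2 hc') (sub_pos.2 (Real.sqrt_lt_sqrt hc'.le hc))
  have hlim : Filter.Tendsto (fun γ : ℝ =>
      Real.exp (γ * (Real.sqrt c' * (Real.sqrt c - Real.sqrt c')))) Filter.atTop Filter.atTop :=
    Real.tendsto_exp_atTop.comp (Filter.tendsto_id.atTop_mul_const hs)
  filter_upwards [hlim.eventually_ge_atTop a, Filter.eventually_ge_atTop 0] with γ hγ h0
  have hle : Real.sqrt (c' * γ) ≤ Real.sqrt (c * γ) :=
    Real.sqrt_le_sqrt (mul_le_mul_of_nonneg_right hc.le h0)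
  have hq := gaussianQ_add_le (x := Real.sqrt (c' * γ)) (sub_nonneg.2 hle)
  rw [add_sub_cancel] at hq
  -- The exponent gained is linear in `γ` with positive slope, so it eventually absorbs the constant
  -- `a`.
  have hexp : Real.sqrt (c' * γ) * (Real.sqrt (c * γ) - Real.sqrt (c' * γ)) =
      γ * (Real.sqrt c' * (Real.sqrt c - Real.sqrt c')) := by
    rw [Real.sqrt_mul hc'.le, Real.sqrt_mul (hc'.trans hc).le]
    linear_combination Real.sqrt c' * (Real.sqrt c - Real.sqrt c') * Real.mul_self_sqrt h0
  rw [hexp] at hq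
  have hQ := gaussianQ_nonneg (Real.sqrt (c * γ))
  calc a * gaussianQ (Real.sqrt (c * γ))
      ≤ Real.exp (γ * (Real.sqrt c' * (Real.sqrt c - Real.sqrt c'))) *
        gaussianQ (Real.sqrt (c * γ)) := mul_le_mul_of_nonneg_right hγ hQ
    _ ≤ Real.exp (γ * (Real.sqrt c' * (Real.sqrt c - Real.sqrt c'))) *
        (Real.exp (-(γ * (Real.sqrt c' * (Real.sqrt c - Real.sqrt c')))) *
          gaussianQ (Real.sqrt (c' * γ))) := mul_le_mul_of_nonneg_left hq (Real.exp_pos _).le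
    _ = gaussianQ (Real.sqrt (c' * γ)) := by
      rw [← mul_assoc, ← Real.exp_add, add_neg_cancel, Real.exp_zero, one_mul]

theorem approxUnionBound_eq {n : ℕ} (A : Finset (Fin (2 ^ n))) (Eb N0 : ℝ) :
    approxUnionBound A Eb N0 = (minWeightCount (polarCode A) : ℝ) *
      gaussianQ (Real.sqrt (2 * (minWeight (polarCode A) : ℝ) *
        ((A.card : ℝ) / (2 : ℝ) ^ n) * (Eb / N0))) := by
  rw [approxUnionBound, mul_div_assoc]

theorem minWeight_pos_and_count_pos {n K : ℕ} (hK : 1 ≤ K) {A : Finset (Fin (2 ^ n))}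
    (hA : IsPolarInfoSet n K A) :
    0 < minWeight (polarCode A) ∧ 0 < minWeightCount (polarCode A) := by
  obtain ⟨r, hdeg, hmax⟩ := exists_max_degree (Finset.card_pos.1 (hK.trans_eq hA.1.symm))
  constructor
  · have hw := minWeight_polarCode hA hdeg hmax
    rw [Nat.pos_iff_ne_zero]
    intro h0
    rw [h0, zero_mul] at hw
    exact absurd hw.symm (by positivity)
  · rw [minWeightCount_polarCode hA hdeg hmax]
    obtain ⟨i, hi, hir⟩ := hmax
    exact Finset.sum_pos (fun _ _ => Nat.two_pow_pos _) ⟨i, Finset.mem_filter.2 ⟨hi, hir⟩⟩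

theorem lemma3 (n K : ℕ) (hK : 1 ≤ K) (hKN : K ≤ 2 ^ n) :
    IsPolarInfoSet n K (mwdInfoSet n K) ∧
    (∀ A' : Finset (Fin (2 ^ n)), IsPolarInfoSet n K A' →
      minWeight (polarCode A') ≤ minWeight (polarCode (mwdInfoSet n K)) ∧
      (minWeight (polarCode A') = minWeight (polarCode (mwdInfoSet n K)) →
        minWeightCount (polarCode (mwdInfoSet n K)) ≤ minWeightCount (polarCode A'))) ∧
    (∃ γ₀ : ℝ, ∀ Eb N0 : ℝ, 0 < Eb → 0 < N0 → γ₀ ≤ Eb / N0 →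
      ∀ A' : Finset (Fin (2 ^ n)), IsPolarInfoSet n K A' →
        approxUnionBound (mwdInfoSet n K) Eb N0 ≤ approxUnionBound A' Eb N0) := by
  refine ⟨isPolarInfoSet_mwdInfoSet hKN, fun A' hA' => mwdInfoSet_optimal hK hKN hA', ?_⟩
  have key : ∀ᶠ γ : ℝ in Filter.atTop, ∀ A' : Finset (Fin (2 ^ n)), IsPolarInfoSet n K A' →
      ∀ Eb N0 : ℝ, Eb / N0 = γ →
        approxUnionBound (mwdInfoSet n K) Eb N0 ≤ approxUnionBound A' Eb N0 := by
    -- There are finitely many sets `A'`, so the thresholds found for each combine into one.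
    refine Filter.eventually_all.2 fun A' => ?_
    by_cases hA' : IsPolarInfoSet n K A'
    swap
    · exact Filter.Eventually.of_forall fun _ h => absurd h hA'
    obtain ⟨h1, h2⟩ := mwdInfoSet_optimal hK hKN hA'
    obtain ⟨hpos, hcount⟩ := minWeight_pos_and_count_pos hK hA'
    -- At equal distance the Gaussian factors agree and the counts decide at every SNR; at strictly
    -- smaller distance the count of `A'` only has to be at least one.
    rcases h1.eq_or_lt with heq | hlt
    · refine Filter.Eventually.of_forall fun γ _ Eb N0 _ => ?_
      rw [approxUnionBound_eq, approxUnionBound_eq, heq, card_mwdInfoSet hKN, hA'.1]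
      exact mul_le_mul_of_nonneg_right (Nat.cast_le.2 (h2 heq)) (gaussianQ_nonneg _)
    · have hR : 0 < (K : ℝ) / (2 : ℝ) ^ n := div_pos (Nat.cast_pos.2 hK) (by positivity)
      have hc' : 0 < 2 * (minWeight (polarCode A') : ℝ) * ((K : ℝ) / (2 : ℝ) ^ n) :=
        mul_pos (mul_pos two_pos (Nat.cast_pos.2 hpos)) hR
      have hc : 2 * (minWeight (polarCode A') : ℝ) * ((K : ℝ) / (2 : ℝ) ^ n) <
          2 * (minWeight (polarCode (mwdInfoSet n K)) : ℝ) * ((K : ℝ) / (2 : ℝ) ^ n) :=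
        mul_lt_mul_of_pos_right (mul_lt_mul_of_pos_left (Nat.cast_lt.2 hlt) two_pos) hR
      filter_upwards [eventually_gaussianQ_le
        (a := (minWeightCount (polarCode (mwdInfoSet n K)) : ℝ)) hc' hc] with γ hγ _ Eb N0 he
      rw [approxUnionBound_eq, approxUnionBound_eq, card_mwdInfoSet hKN, hA'.1, he]
      exact hγ.trans (le_mul_of_one_le_left (gaussianQ_nonneg _) (Nat.one_le_cast.2 hcount))
  obtain ⟨γ₀, h⟩ := Filter.eventually_atTop.1 key
  exact ⟨γ₀, fun Eb N0 _ _ hγ A' hA' => h _ hγ A' hA' Eb N0 rfl⟩
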